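/- Let $p,n\in\mathbb N$ with $41\le p\le n$, and let $\Theta_1,\dots,\Theta_p$ be independent random points, each uniformly distributed on the unit sphere $\mathbb S^{n-1}\subset\mathbb R^n$. Let $$W:=\log \mathrm{Vol}_p\Big\{\sum_{i=1}^p s_i\Theta_i : s_1,\dots,s_p\ge 0,\ \sum_{i=1}^p s_i\le 1\Big\}$$ be the logarithm of the $p$-dimensional volume of the simplex with vertices $0,\Theta_1,\dots,\Theta_p$. Then this volume is almost surely positive, $\mathbb E[W^2]<\infty$ and $\mathrm{Var}[W]>0$, and the standardized log-volume $\widetilde W:=(W-\mathbb E[W])/\sqrt{\mathrm{Var}[W]}$ satisfies $$\sup_{r\in\mathbb R}\Big|\mathbb P[\widetilde W<r]-\int_{-\infty}^r \frac{e^{-u^2/2}}{\sqrt{2\pi}}\,\mathrm du\Big|\ \le\ \frac{28\,\theta^2}{n(1-\theta)\big[\log\frac1{1-\theta}-\theta\big]^{3/2}},\qquad \theta:=\frac{p-1}{n}.$$ In particular, for every $\phi\in(0,1)$ with $\theta\le\phi$ the right-hand side, and hence the left-hand side, is at most $\dfrac{2\sqrt2\cdot 28}{(1-\phi)(p-1)}$.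 -/

import Mathlib

open MeasureTheory ProbabilityTheory Set
open scoped ENNReal

noncomputable section

namespace SphericalSimplex

/-- The uniform probability distribution on the unit sphere `S^{n-1}` of `ℝⁿ`: the surface measure
induced by Lebesgue measure, normalized to total mass one (for `n ≥ 1`). -/
def uniformSphere (n : ℕ) : Measure (Metric.sphere (0 : EuclideanSpace ℝ (Fin n)) 1) :=
  ((volume : Measure (EuclideanSpace ℝ (Fin n))).toSphere univ)⁻¹ •
    (volume : Measure (EuclideanSpace ℝ (Fin n))).toSphere

/-- The simplex with vertices `0, y₁, …, y_p` in `ℝⁿ`. -/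
def originSimplex {n p : ℕ} (y : Fin p → EuclideanSpace ℝ (Fin n)) :
    Set (EuclideanSpace ℝ (Fin n)) :=
  {x | ∃ s : Fin p → ℝ, (∀ i, 0 ≤ s i) ∧ ∑ i, s i ≤ 1 ∧ x = ∑ i, s i • y i}

/-- The `p`-dimensional volume of the simplex with vertices `0, y₁, …, y_p`. Here `μHE[p]` is the
`p`-dimensional Hausdorff measure, normalized so that it is Lebesgue measure on `p`-dimensional
Euclidean subspaces. -/
def simplexVolume {n p : ℕ} (y : Fin p → EuclideanSpace ℝ (Fin n)) : ℝ :=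
  (μHE[p] : Measure (EuclideanSpace ℝ (Fin n))).real (originSimplex y)

/-- The log-volume of the simplex spanned by the origin and `p` points of the unit sphere. -/
def logVolume {n p : ℕ} {Ω : Type*}
    (Θ : Fin p → Ω → Metric.sphere (0 : EuclideanSpace ℝ (Fin n)) 1) (ω : Ω) : ℝ :=
  Real.log (simplexVolume fun i => (Θ i ω : EuclideanSpace ℝ (Fin n)))

/-- The standardization `(X - E X) / √(Var X)` of a real random variable. -/
def standardize {Ω : Type*} [MeasurableSpace Ω] (P : Measure Ω) (X : Ω → ℝ) (ω : Ω) : ℝ :=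
  (X ω - ∫ ω', X ω' ∂P) / √(Var[X; P])

/-- The Kolmogorov–Smirnov distance between a real random variable `X` and a standard Gaussian
random variable (a supremum of numbers in `[0, 1]` when `P` is a probability measure). -/
def ksDistGaussian {Ω : Type*} [MeasurableSpace Ω] (P : Measure Ω) (X : Ω → ℝ) : ℝ :=
  ⨆ r : ℝ, |P.real {ω | X ω < r} - ∫ u in Iio r, Real.exp (-u ^ 2 / 2) / √(2 * Real.pi)|

/-- The bound `28 θ² / (n (1-θ) [log (1/(1-θ)) - θ]^{3/2})`. -/
def berryBound (n : ℕ) (θ : ℝ) : ℝ :=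
  28 * θ ^ 2 / (n * (1 - θ) * (Real.log (1 / (1 - θ)) - θ) ^ (3 / 2 : ℝ))

end SphericalSimplex

end

noncomputable section

namespace SphericalSimplex

open Filter Topology Asymptotics InnerProductSpace

/-! The simplex is a linear image of the corner simplex, so its volume is a positive constant times
the product of the Gram-Schmidt norms of the points (`simplexVolume_eq`). The norm coming after k
points is the distance from a uniform point to the span of those k points, whose law depends only on
k and n. Up to an additive constant, which standardization removes, the log-volume therefore has
characteristic function `∏ k, logDistCharFun n k`, an explicit product of Gamma ratios
(`charFun_log_sphereVolume`).

Gauss's product for Gamma turns each ratio into an infinite product of factors (1 + it/y)/(1 + it/x)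
with x ≤ y (`tendsto_prod_gammaFactor`). Each factor has modulus nonincreasing in |t|, and log(1 +
iu) is quadratic up to a cubic error for every real u. So the characteristic function equals exp(ict
- vt²/2 + R) with |R| ≤ K|t|³/6 for all real t (`exists_expansion_prod_logDistCharFun`), where c and
v must be the mean and the variance (`memLp_integral_variance_of_charFun`). Telescoping comparisons
give K = 4.8 θ²/(n(1-θ)) and v ≥ (log(1/(1-θ)) - θ)/2.

If K/v^(3/2) ≤ δ ≤ 1/2, the distance to the Gaussian is at most 2δ
(`abs_measureReal_Iio_sub_gaussian_le`). Indicators are replaced by ramps of width 2δ, which are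
differences of absolute values, and π|x| = ∫ (1 - cos tx)/t² dt expresses their expectations through
characteristic functions. For |t| ≤ 1/δ the cubic error is absorbed by the Gaussian decay; beyond,
monotonicity of the modulus preserves the bound reached at 1/δ. -/

/-! ### The Fourier integral of the absolute value. -/

/-- Combines 1 - cos ≤ 2 with 1 - cos(tx) ≤ (tx)²/2, so that one integrable majorant serves both
near 0 and at infinity. -/
lemma one_sub_cos_div_sq_le (x t : ℝ) :
    (1 - Real.cos (t * x)) / t ^ 2 ≤ (2 + x ^ 2 / 2) * (1 + t ^ 2)⁻¹ := by
  rcases eq_or_ne t 0 with rfl | ht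
  · simp; positivity
  have ht2 : 0 < t ^ 2 := by positivity
  rw [← div_eq_mul_inv, div_le_div_iff₀ ht2 (by positivity)]
  have h1 := Real.one_sub_sq_div_two_le_cos (x := t * x)
  have h2 := Real.neg_one_le_cos (t * x)
  nlinarith

lemma one_sub_cos_div_sq_nonneg (x t : ℝ) : 0 ≤ (1 - Real.cos (t * x)) / t ^ 2 :=
  div_nonneg (by linarith [Real.cos_le_one (t * x)]) (by positivity)

lemma integrable_one_sub_cos_div_sq (x : ℝ) :
    Integrable (fun t : ℝ => (1 - Real.cos (t * x)) / t ^ 2) := by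
  refine (integrable_inv_one_add_sq.const_mul (2 + x ^ 2 / 2)).mono'
    (Measurable.aestronglyMeasurable (by fun_prop)) (ae_of_all _ fun t => ?_)
  rw [Real.norm_of_nonneg (one_sub_cos_div_sq_nonneg x t)]
  exact one_sub_cos_div_sq_le x t

lemma integral_one_sub_cos_scale (x : ℝ) :
    ∫ t : ℝ, (1 - Real.cos (t * x)) / t ^ 2 = |x| * ∫ t : ℝ, (1 - Real.cos t) / t ^ 2 := by
  rcases eq_or_ne x 0 with rfl | hx
  · simp
  have h := Measure.integral_comp_mul_right (fun t : ℝ => (1 - Real.cos t) / t ^ 2) x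
  have h2 : ∀ t : ℝ, (1 - Real.cos (t * x)) / t ^ 2
      = x ^ 2 * ((1 - Real.cos (t * x)) / (t * x) ^ 2) := by
    intro t
    rcases eq_or_ne t 0 with rfl | ht
    · simp
    · field_simp
  simp_rw [h2]
  rw [integral_const_mul, h, smul_eq_mul, abs_inv, ← mul_assoc]
  congr 1
  rw [← sq_abs]
  field_simp

lemma integral_exp_neg_mul_cos (t : ℝ) :
    ∫ x in Ioi (0 : ℝ), Real.exp (-x) * Real.cos (t * x) = (1 + t ^ 2)⁻¹ := by
  have hre : (-1 + t * Complex.I : ℂ).re < 0 := by simp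
  have h := integral_exp_mul_complex_Ioi hre 0
  have hi := integrableOn_exp_mul_complex_Ioi hre 0
  have h3 := congrArg Complex.re h
  have h4 := integral_re hi
  simp only [RCLike.re_to_complex] at h4
  rw [← h4] at h3
  have h5 : ∀ x : ℝ, (Complex.exp ((-1 + t * Complex.I) * x)).re
      = Real.exp (-x) * Real.cos (t * x) := by
    intro x
    rw [Complex.exp_re]
    simp
  simp_rw [h5] at h3
  rw [h3]
  simp [Complex.div_re, Complex.normSq_apply]
  ring

lemma integrable_exp_mul_one_sub_cos_prod :
    Integrable (fun z : ℝ × ℝ => Real.exp (-z.1) * ((1 - Real.cos (z.2 * z.1)) / z.2 ^ 2))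
      ((volume.restrict (Ioi (0 : ℝ))).prod volume) := by
  have h1 : Integrable (fun x : ℝ => Real.exp (-x) * (2 + x ^ 2 / 2))
      (volume.restrict (Ioi (0 : ℝ))) := by
    have ha := Real.GammaIntegral_convergent (s := 1) (by norm_num)
    have hb := Real.GammaIntegral_convergent (s := 3) (by norm_num)
    have hab : IntegrableOn (fun x : ℝ => 2 * (Real.exp (-x) * x ^ (1 - 1 : ℝ))
        + 1 / 2 * (Real.exp (-x) * x ^ (3 - 1 : ℝ))) (Ioi 0) :=
      (ha.const_mul 2).add (hb.const_mul (1 / 2))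
    refine hab.congr_fun (fun x hx => ?_) measurableSet_Ioi
    have : x ^ (3 - 1 : ℝ) = x ^ 2 := by
      rw [← Real.rpow_natCast]; norm_num
    simp only [this, sub_self, Real.rpow_zero]
    ring
  refine (h1.mul_prod integrable_inv_one_add_sq).mono'
    (Measurable.aestronglyMeasurable (by fun_prop)) (ae_of_all _ fun z => ?_)
  rw [Real.norm_of_nonneg (mul_nonneg (Real.exp_pos _).le (one_sub_cos_div_sq_nonneg _ _)),
    mul_assoc]
  exact mul_le_mul_of_nonneg_left (one_sub_cos_div_sq_le _ _) (Real.exp_pos _).le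

/-- Fubini for (1 - cos tx)/t² against e^(-x) dx: integrating in t first gives c ∫ x e^(-x) dx = c
by scaling, and integrating in x first gives ∫ dt/(1 + t²) = π. -/
lemma integral_one_sub_cos_div_sq_one :
    ∫ t : ℝ, (1 - Real.cos t) / t ^ 2 = Real.pi := by
  have hswap := integral_integral_swap
    (f := fun x t : ℝ => Real.exp (-x) * ((1 - Real.cos (t * x)) / t ^ 2))
    integrable_exp_mul_one_sub_cos_prod
  simp_rw [integral_const_mul, integral_one_sub_cos_scale] at hswap
  set c := ∫ t : ℝ, (1 - Real.cos t) / t ^ 2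
  have hl : ∫ x in Ioi (0 : ℝ), Real.exp (-x) * (|x| * c) = c := by
    have hg := Real.Gamma_eq_integral (s := 2) (by norm_num)
    rw [Real.Gamma_two] at hg
    have : ∫ x in Ioi (0 : ℝ), Real.exp (-x) * (|x| * c)
        = ∫ x in Ioi (0 : ℝ), (Real.exp (-x) * x ^ (2 - 1 : ℝ)) * c := by
      refine setIntegral_congr_fun measurableSet_Ioi fun x hx => ?_
      have hx' : (0 : ℝ) < x := hx
      have : x ^ (2 - 1 : ℝ) = x := by norm_num
      simp only [this, abs_of_pos hx', mul_assoc]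
    rw [this, integral_mul_const, ← hg, one_mul]
  have hE : IntegrableOn (fun x : ℝ => Real.exp (-x)) (Ioi 0) := by
    simpa using Real.GammaIntegral_convergent (s := 1) (by norm_num)
  have hE1 : ∫ x in Ioi (0 : ℝ), Real.exp (-x) = 1 := by
    simpa using integral_exp_neg_mul_cos 0
  have hr : ∀ t : ℝ, t ≠ 0 → ∫ x in Ioi (0 : ℝ), Real.exp (-x) * ((1 - Real.cos (t * x)) / t ^ 2)
      = (1 + t ^ 2)⁻¹ := by
    intro t ht
    have hC : IntegrableOn (fun x : ℝ => Real.exp (-x) * Real.cos (t * x)) (Ioi 0) := by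
      refine hE.mono' (Measurable.aestronglyMeasurable (by fun_prop)) (ae_of_all _ fun x => ?_)
      rw [norm_mul, Real.norm_of_nonneg (Real.exp_pos _).le]
      exact mul_le_of_le_one_right (Real.exp_pos _).le (Real.abs_cos_le_one _)
    have : ∀ x : ℝ, Real.exp (-x) * ((1 - Real.cos (t * x)) / t ^ 2)
        = (Real.exp (-x) - Real.exp (-x) * Real.cos (t * x)) * (t ^ 2)⁻¹ := fun x => by ring
    simp_rw [this]
    rw [integral_mul_const, integral_sub hE hC, integral_exp_neg_mul_cos, hE1]
    have : 1 + t ^ 2 ≠ 0 := by positivity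
    field_simp
    ring
  rw [hl] at hswap
  rw [hswap, ← integral_univ_inv_one_add_sq]
  refine integral_congr_ae ?_
  filter_upwards [compl_mem_ae_iff.2 (measure_singleton (0 : ℝ))] with t ht
  exact hr t ht

lemma integral_one_sub_cos_div_sq (x : ℝ) :
    ∫ t : ℝ, (1 - Real.cos (t * x)) / t ^ 2 = Real.pi * |x| := by
  rw [integral_one_sub_cos_scale, integral_one_sub_cos_div_sq_one, mul_comm]

/-! ### Ramp functions and characteristic functions. -/

section Smoothing

variable {ν : Measure ℝ} [IsProbabilityMeasure ν]

lemma integrable_one_sub_cos_prod (hint : Integrable id ν) (a : ℝ) :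
    Integrable (fun z : ℝ × ℝ => (1 - Real.cos (z.2 * (z.1 - a))) / z.2 ^ 2)
      (ν.prod volume) := by
  rw [integrable_prod_iff (Measurable.aestronglyMeasurable (by fun_prop))]
  refine ⟨ae_of_all _ fun x => integrable_one_sub_cos_div_sq (x - a), ?_⟩
  have h : ∀ x : ℝ, ∫ t : ℝ, ‖(1 - Real.cos (t * (x - a))) / t ^ 2‖ = Real.pi * |x - a| := by
    intro x
    rw [← integral_one_sub_cos_div_sq]
    exact integral_congr_ae (ae_of_all _ fun t =>
      Real.norm_of_nonneg (one_sub_cos_div_sq_nonneg (x - a) t))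
  simp only [h]
  exact ((hint.sub (integrable_const a)).abs).const_mul _

lemma integral_cos_eq_charFun (ν : Measure ℝ) [IsProbabilityMeasure ν] (a t : ℝ) :
    ∫ x, Real.cos (t * (x - a)) ∂ν = (Complex.exp (-(t * a * Complex.I)) * charFun ν t).re := by
  rw [charFun_apply_real, ← integral_const_mul]
  have hi : Integrable (fun x : ℝ => Complex.exp (-(t * a * Complex.I))
      * Complex.exp (t * x * Complex.I)) ν := by
    refine (integrable_const (1 : ℝ)).mono' (Continuous.aestronglyMeasurable (by fun_prop))
      (ae_of_all _ fun x => ?_)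
    rw [← Complex.exp_add, Complex.norm_exp]
    simp
  have h4 := integral_re hi
  simp only [RCLike.re_to_complex] at h4
  rw [← h4]
  congr 1 with x
  rw [← Complex.exp_add, Complex.exp_re]
  simp
  ring_nf

lemma integral_abs_sub_eq (hint : Integrable id ν) (a : ℝ) :
    Real.pi * ∫ x, |x - a| ∂ν
      = ∫ t : ℝ, (1 - (Complex.exp (-(t * a * Complex.I)) * charFun ν t).re) / t ^ 2 := by
  rw [← integral_const_mul]
  simp_rw [← integral_one_sub_cos_div_sq]
  rw [integral_integral_swap (integrable_one_sub_cos_prod hint a)]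
  congr 1 with t
  rw [integral_div, integral_sub (integrable_const _), integral_cos_eq_charFun]
  · simp
  · refine (integrable_const (1 : ℝ)).mono' (Continuous.aestronglyMeasurable (by fun_prop))
      (ae_of_all _ fun x => Real.abs_cos_le_one _)

lemma integrable_charFun_div_sq (hint : Integrable id ν) (a : ℝ) :
    Integrable fun t : ℝ =>
      (1 - (Complex.exp (-(t * a * Complex.I)) * charFun ν t).re) / t ^ 2 := by
  refine (integrable_one_sub_cos_prod hint a).integral_prod_right.congr (ae_of_all _ fun t => ?_)
  simp only
  rw [integral_div, integral_sub (integrable_const _), integral_cos_eq_charFun]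
  · simp
  · refine (integrable_const (1 : ℝ)).mono' (Continuous.aestronglyMeasurable (by fun_prop))
      (ae_of_all _ fun x => Real.abs_cos_le_one _)

/-- The piecewise linear function equal to `1` on `(-∞, r]` and to `0` on `[r + 2ε, ∞)`. -/
def ramp (r ε u : ℝ) : ℝ := 1 / 2 + (|u - (r + 2 * ε)| - |u - r|) / (4 * ε)

lemma ramp_eq_one {r ε u : ℝ} (hε : 0 < ε) (h : u ≤ r) : ramp r ε u = 1 := by
  rw [ramp, abs_of_nonpos (by linarith), abs_of_nonpos (by linarith)]
  field_simp
  ring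

lemma ramp_eq_zero {r ε u : ℝ} (hε : 0 < ε) (h : r + 2 * ε ≤ u) : ramp r ε u = 0 := by
  rw [ramp, abs_of_nonneg (by linarith), abs_of_nonneg (by linarith)]
  field_simp
  ring

lemma ramp_mem {r ε u : ℝ} (hε : 0 < ε) : 0 ≤ ramp r ε u ∧ ramp r ε u ≤ 1 := by
  rcases le_total u r with h | h
  · simp [ramp_eq_one hε h]
  rcases le_total (r + 2 * ε) u with h' | h'
  · simp [ramp_eq_zero hε h']
  rw [ramp, abs_of_nonpos (by linarith), abs_of_nonneg (by linarith)]
  have : 1 / 2 + (-(u - (r + 2 * ε)) - (u - r)) / (4 * ε) = (r + 2 * ε - u) / (2 * ε) := by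
    field_simp; ring
  rw [this]
  exact ⟨div_nonneg (by linarith) (by linarith), (div_le_one (by linarith)).2 (by linarith)⟩

lemma integral_ramp (hint : Integrable id ν) {r ε : ℝ} :
    ∫ u, ramp r ε u ∂ν
      = 1 / 2 + (∫ u, |u - (r + 2 * ε)| ∂ν - ∫ u, |u - r| ∂ν) / (4 * ε) := by
  have h : ∀ a : ℝ, Integrable (fun u => |u - a|) ν :=
    fun a => (hint.sub (integrable_const a)).abs
  have h2 : Integrable (fun u => (|u - (r + 2 * ε)| - |u - r|) / (4 * ε)) ν :=
    ((h _).sub (h _)).div_const _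
  unfold ramp
  rw [integral_add (integrable_const _) h2, integral_div (4 * ε),
    integral_sub (h _) (h _)]
  simp

/-- A ramp is a difference of two absolute values, so its transform carries the multiplier e^(-itr)
- e^(-it(r+2ε)), of modulus at most min(2, 2ε|t|). The extra power of t near 0 makes the t⁻² weight
harmless, and the t⁻² weight gives integrability at infinity without truncation. -/
lemma abs_integral_ramp_sub_le {μ : Measure ℝ} [IsProbabilityMeasure μ]
    (hν : Integrable id ν) (hμ : Integrable id μ) {r ε : ℝ} (hε : 0 < ε) {G : ℝ → ℝ}
    (hG : Integrable G)
    (hle : ∀ t : ℝ, min 2 (2 * ε * |t|) * ‖charFun ν t - charFun μ t‖ / t ^ 2 ≤ G t) :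
    |∫ u, ramp r ε u ∂ν - ∫ u, ramp r ε u ∂μ| ≤ (∫ t, G t) / (4 * Real.pi * ε) := by
  have key : Real.pi * (4 * ε) * (∫ u, ramp r ε u ∂ν - ∫ u, ramp r ε u ∂μ)
      = ∫ t : ℝ,
        ((Complex.exp (-(t * r * Complex.I)) - Complex.exp (-(t * (r + 2 * ε) * Complex.I)))
          * (charFun ν t - charFun μ t)).re / t ^ 2 := by
    rw [integral_ramp hν, integral_ramp hμ]
    have e : Real.pi * (4 * ε) * (1 / 2 + (∫ u, |u - (r + 2 * ε)| ∂ν - ∫ u, |u - r| ∂ν) / (4 * ε)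
        - (1 / 2 + (∫ u, |u - (r + 2 * ε)| ∂μ - ∫ u, |u - r| ∂μ) / (4 * ε)))
        = (Real.pi * (∫ u, |u - (r + 2 * ε)| ∂ν) - Real.pi * (∫ u, |u - r| ∂ν))
          - (Real.pi * (∫ u, |u - (r + 2 * ε)| ∂μ) - Real.pi * (∫ u, |u - r| ∂μ)) := by
      field_simp
      ring
    have i1 := integrable_charFun_div_sq hν
    have i2 := integrable_charFun_div_sq hμ
    rw [e, integral_abs_sub_eq hν, integral_abs_sub_eq hν, integral_abs_sub_eq hμ,
      integral_abs_sub_eq hμ, ← integral_sub (i1 _) (i1 _), ← integral_sub (i2 _) (i2 _),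
      ← integral_sub (by exact (i1 _).sub (i1 _)) (by exact (i2 _).sub (i2 _))]
    congr 1 with t
    simp only [Complex.sub_re, sub_mul, mul_sub]
    push_cast
    ring
  have hb : |Real.pi * (4 * ε) * (∫ u, ramp r ε u ∂ν - ∫ u, ramp r ε u ∂μ)| ≤ ∫ t, G t := by
    rw [key, ← Real.norm_eq_abs]
    refine norm_integral_le_of_norm_le hG (ae_of_all _ fun t => (le_trans ?_ (hle t)))
    rw [norm_div, Real.norm_of_nonneg (sq_nonneg t)]
    refine div_le_div_of_nonneg_right ?_ (sq_nonneg t)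
    refine (Complex.abs_re_le_norm _).trans ?_
    rw [norm_mul]
    refine mul_le_mul_of_nonneg_right ?_ (norm_nonneg _)
    refine le_min ((norm_sub_le _ _).trans ?_) ?_
    · rw [Complex.norm_exp, Complex.norm_exp]
      norm_num
    · have h1 : Complex.exp (-(t * r * Complex.I)) - Complex.exp (-(t * (r + 2 * ε) * Complex.I))
          = Complex.exp (-(t * (r + 2 * ε) * Complex.I))
            * (Complex.exp (Complex.I * ((2 * ε * t : ℝ) : ℂ)) - 1) := by
        rw [mul_sub, ← Complex.exp_add]
        push_cast
        ring_nf
      rw [h1, norm_mul, Complex.norm_exp]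
      refine (mul_le_of_le_one_left (norm_nonneg _) (by simp)).trans ?_
      refine (Real.norm_exp_I_mul_ofReal_sub_one_le).trans ?_
      rw [Real.norm_eq_abs, abs_mul, abs_of_pos (by positivity : 0 < 2 * ε)]
  rw [abs_mul, abs_of_pos (by positivity)] at hb
  rw [le_div_iff₀ (by positivity)]
  linarith

lemma gaussianReal_real_Icc_le (a b : ℝ) (hab : a ≤ b) :
    (gaussianReal 0 1).real (Icc a b) ≤ (b - a) * (2 / 5) := by
  rw [measureReal_def, gaussianReal_apply_eq_integral 0 one_ne_zero,
    ENNReal.toReal_ofReal (integral_nonneg fun x => gaussianPDFReal_nonneg 0 1 x)]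
  have hle : ∀ x, gaussianPDFReal 0 1 x ≤ 2 / 5 := by
    intro x
    rw [gaussianPDFReal]
    have h1 : Real.exp (-(x - 0) ^ 2 / (2 * ((1 : NNReal) : ℝ))) ≤ 1 := by
      rw [Real.exp_le_one_iff]
      have := sq_nonneg (x - 0)
      simp only [NNReal.coe_one]
      linarith
    have h2 : (√(2 * Real.pi * ((1 : NNReal) : ℝ)))⁻¹ ≤ 2 / 5 := by
      rw [inv_le_comm₀ (by positivity) (by norm_num)]
      refine Real.le_sqrt_of_sq_le ?_
      have := Real.pi_gt_d2
      norm_num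
      linarith
    calc _ ≤ (√(2 * Real.pi * ((1 : NNReal) : ℝ)))⁻¹ * 1 := by gcongr
      _ ≤ _ := by linarith
  have h := setIntegral_mono_on (s := Icc a b) (integrable_gaussianPDFReal 0 1).integrableOn
    (integrableOn_const (C := (2 / 5 : ℝ)) (by simp) (by simp)) measurableSet_Icc
    (fun x _ => hle x)
  refine h.trans ?_
  rw [setIntegral_const, Real.volume_real_Icc_of_le hab, smul_eq_mul]

end Smoothing

/-! ### A Berry-Esseen bound from a global cubic expansion. -/

lemma integrable_indicator_inv_sq {T : ℝ} (hT : 0 < T) :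
    Integrable (fun t : ℝ => (Ioi T).indicator (fun x => x ^ (-2 : ℝ)) |t|) := by
  have h0 : Integrable ((Ioi T).indicator fun x : ℝ => x ^ (-2 : ℝ)) :=
    (integrable_indicator_iff measurableSet_Ioi).2
      (integrableOn_Ioi_rpow_of_lt (by norm_num) hT)
  have hpos : IntegrableOn (fun t : ℝ => (Ioi T).indicator (fun x => x ^ (-2 : ℝ)) |t|) (Ici 0) :=
    h0.integrableOn.congr_fun (fun t ht => by rw [abs_of_nonneg ht]) measurableSet_Ici
  have hneg : IntegrableOn (fun t : ℝ => (Ioi T).indicator (fun x => x ^ (-2 : ℝ)) |t|) (Iio 0) :=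
    h0.comp_neg.integrableOn.congr_fun (fun t ht => by rw [abs_of_neg ht]) measurableSet_Iio
  have := hneg.union hpos
  rwa [Iio_union_Ici, integrableOn_univ] at this

lemma integral_indicator_inv_sq {T : ℝ} (hT : 0 < T) :
    ∫ t : ℝ, (Ioi T).indicator (fun x => x ^ (-2 : ℝ)) |t| = 2 / T := by
  rw [integral_comp_abs (f := (Ioi T).indicator (fun x => x ^ (-2 : ℝ))),
    setIntegral_indicator measurableSet_Ioi, inter_eq_right.2 (Ioi_subset_Ioi hT.le),
    integral_Ioi_rpow_of_lt (by norm_num) hT]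
  norm_num [Real.rpow_neg_one]
  ring

lemma sq_mul_exp_neg_le (t : ℝ) :
    t ^ 2 * Real.exp (-t ^ 2 / 3) ≤ 3 * Real.exp (-(1 / 6) * t ^ 2) := by
  have h : t ^ 2 / 3 ≤ Real.exp (t ^ 2 / 6) := by
    have := Real.quadratic_le_exp_of_nonneg (x := t ^ 2 / 6) (by positivity)
    nlinarith [sq_nonneg (t ^ 2 / 6 - 1)]
  have e : Real.exp (-(1 / 6) * t ^ 2) = Real.exp (t ^ 2 / 6) * Real.exp (-t ^ 2 / 3) := by
    rw [← Real.exp_add]; ring_nf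
  rw [e]
  nlinarith [Real.exp_pos (-t ^ 2 / 3)]

lemma norm_exp_sub_one_le_mul_exp (z : ℂ) : ‖Complex.exp z - 1‖ ≤ ‖z‖ * Real.exp ‖z‖ := by
  simpa using Complex.norm_exp_sub_sum_le_norm_mul_exp z 1

section
variable {ν : Measure ℝ} {δ : ℝ}

lemma charFun_stdGaussian_eq (t : ℝ) :
    charFun (gaussianReal 0 1) t = Complex.exp (-(t : ℂ) ^ 2 / 2) := by
  rw [charFun_gaussianReal]; simp; ring_nf

/-- This fixes the cutoff 1/δ: below it the error costs at most t²/6 in the exponent, so a decay of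
e^(-t²/3) survives. -/
lemma norm_exp_neg_sq_half_add_le {R : ℂ} {t : ℝ} (hδ : 0 < δ) (ht : |t| ≤ 1 / δ)
    (hR : ‖R‖ ≤ δ * |t| ^ 3 / 6) : ‖R‖ ≤ t ^ 2 / 6 := by
  refine hR.trans ?_
  rw [le_div_iff₀ hδ] at ht
  rw [← sq_abs t]
  nlinarith [sq_nonneg |t|]

lemma norm_charFun_sub_gaussian_le_of_abs_le (hδ : 0 < δ)
    (hR : ∀ t : ℝ, ∃ R : ℂ, ‖R‖ ≤ δ * |t| ^ 3 / 6 ∧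
      charFun ν t = Complex.exp (-(t : ℂ) ^ 2 / 2 + R))
    {t : ℝ} (ht : |t| ≤ 1 / δ) :
    ‖charFun ν t - charFun (gaussianReal 0 1) t‖ ≤ δ * |t| ^ 3 / 6 * Real.exp (-t ^ 2 / 3) := by
  obtain ⟨R, h1, h2⟩ := hR t
  have h3 := norm_exp_neg_sq_half_add_le hδ ht h1
  have hn : ‖Complex.exp (-(t : ℂ) ^ 2 / 2)‖ = Real.exp (-t ^ 2 / 2) := by
    rw [Complex.norm_exp]; norm_cast
  rw [h2, charFun_stdGaussian_eq, Complex.exp_add, ← mul_sub_one, norm_mul, hn]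
  calc Real.exp (-t ^ 2 / 2) * ‖Complex.exp R - 1‖
      ≤ Real.exp (-t ^ 2 / 2) * (‖R‖ * Real.exp ‖R‖) := by
        gcongr; exact norm_exp_sub_one_le_mul_exp R
    _ ≤ Real.exp (-t ^ 2 / 2) * (δ * |t| ^ 3 / 6 * Real.exp (t ^ 2 / 6)) := by gcongr
    _ = δ * |t| ^ 3 / 6 * (Real.exp (-t ^ 2 / 2) * Real.exp (t ^ 2 / 6)) := by ring
    _ = _ := by rw [← Real.exp_add]; ring_nf

/-- The expansion is useless beyond the cutoff; there the modulus is compared with its value at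
exactly 1/δ. -/
lemma norm_charFun_sub_gaussian_le_of_lt_abs (hδ : 0 < δ)
    (hR : ∀ t : ℝ, ∃ R : ℂ, ‖R‖ ≤ δ * |t| ^ 3 / 6 ∧
      charFun ν t = Complex.exp (-(t : ℂ) ^ 2 / 2 + R))
    (hanti : ∀ s t : ℝ, |s| ≤ |t| → ‖charFun ν t‖ ≤ ‖charFun ν s‖)
    {t : ℝ} (ht : 1 / δ < |t|) :
    ‖charFun ν t - charFun (gaussianReal 0 1) t‖ ≤ 2 * Real.exp (-(1 / δ) ^ 2 / 3) := by
  have hT : 0 < 1 / δ := by positivity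
  have h1 : ‖charFun ν t‖ ≤ Real.exp (-(1 / δ) ^ 2 / 3) := by
    refine (hanti (1 / δ) t (by rw [abs_of_pos hT]; exact ht.le)).trans ?_
    obtain ⟨R, h1, h2⟩ := hR (1 / δ)
    have h3 := norm_exp_neg_sq_half_add_le hδ (abs_of_pos hT).le h1
    rw [h2, Complex.norm_exp, Real.exp_le_exp]
    have h4 : (-((1 / δ : ℝ) : ℂ) ^ 2 / 2 + R).re = -(1 / δ) ^ 2 / 2 + R.re := by
      rw [Complex.add_re]; norm_cast
    rw [h4]
    have := (Complex.re_le_norm R).trans h3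
    linarith
  have h2 : ‖charFun (gaussianReal 0 1) t‖ ≤ Real.exp (-(1 / δ) ^ 2 / 3) := by
    have hn : ‖Complex.exp (-(t : ℂ) ^ 2 / 2)‖ = Real.exp (-t ^ 2 / 2) := by
      rw [Complex.norm_exp]; norm_cast
    rw [charFun_stdGaussian_eq, hn, Real.exp_le_exp]
    have : (1 / δ) ^ 2 ≤ t ^ 2 := by rw [← sq_abs t]; gcongr
    nlinarith [sq_nonneg t]
  linarith [norm_sub_le (charFun ν t) (charFun (gaussianReal 0 1) t)]

/-- The pointwise majorant of the difference of characteristic functions used for smoothing. -/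
def smoothingMajorant (δ t : ℝ) : ℝ :=
  δ ^ 2 * Real.exp (-(1 / 6) * t ^ 2) +
    4 * Real.exp (-(1 / δ) ^ 2 / 3) * (Ioi (1 / δ)).indicator (fun x => x ^ (-2 : ℝ)) |t|

lemma integrable_smoothingMajorant (hδ : 0 < δ) : Integrable (smoothingMajorant δ) :=
  ((integrable_exp_neg_mul_sq (by norm_num)).const_mul _).add
    ((integrable_indicator_inv_sq (by positivity)).const_mul _)

lemma integral_smoothingMajorant (hδ : 0 < δ) :
    ∫ t, smoothingMajorant δ t =
      δ ^ 2 * √(6 * Real.pi) + 8 * Real.exp (-(1 / δ) ^ 2 / 3) * δ := by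
  unfold smoothingMajorant
  rw [integral_add ((integrable_exp_neg_mul_sq (by norm_num)).const_mul _)
    ((integrable_indicator_inv_sq (by positivity)).const_mul _), integral_const_mul,
    integral_const_mul, integral_gaussian, integral_indicator_inv_sq (by positivity)]
  congr 1
  · congr 2; field_simp
  · field_simp; ring

lemma min_mul_norm_charFun_sub_le (hδ : 0 < δ)
    (hR : ∀ t : ℝ, ∃ R : ℂ, ‖R‖ ≤ δ * |t| ^ 3 / 6 ∧
      charFun ν t = Complex.exp (-(t : ℂ) ^ 2 / 2 + R))
    (hanti : ∀ s t : ℝ, |s| ≤ |t| → ‖charFun ν t‖ ≤ ‖charFun ν s‖) (t : ℝ) :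
    min 2 (2 * δ * |t|) * ‖charFun ν t - charFun (gaussianReal 0 1) t‖ / t ^ 2
      ≤ smoothingMajorant δ t := by
  unfold smoothingMajorant
  rcases eq_or_ne t 0 with rfl | ht0
  · refine le_trans (by simp) (add_nonneg (by positivity)
      (mul_nonneg (by positivity) (indicator_nonneg (fun x hx => ?_) _)))
    have : 0 < x := lt_trans (by positivity) (mem_Ioi.1 hx)
    positivity
  rw [div_le_iff₀ (by positivity)]
  rcases le_or_gt |t| (1 / δ) with h | h
  · rw [indicator_of_notMem (by simpa using h), mul_zero, add_zero]
    have h1 := norm_charFun_sub_gaussian_le_of_abs_le hδ hR h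
    calc _ ≤ (2 * δ * |t|) * (δ * |t| ^ 3 / 6 * Real.exp (-t ^ 2 / 3)) := by
          gcongr; exact min_le_right _ _
      _ = δ ^ 2 * |t| ^ 2 / 3 * (|t| ^ 2 * Real.exp (-t ^ 2 / 3)) := by ring
      _ ≤ δ ^ 2 * |t| ^ 2 / 3 * (3 * Real.exp (-(1 / 6) * t ^ 2)) := by
          refine mul_le_mul_of_nonneg_left ?_ (by positivity)
          rw [sq_abs]; exact sq_mul_exp_neg_le t
      _ = _ := by rw [sq_abs]; ring
  · rw [indicator_of_mem (by exact h)]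
    have h1 := norm_charFun_sub_gaussian_le_of_lt_abs hδ hR hanti h
    have h2 : |t| ^ (-2 : ℝ) * t ^ 2 = 1 := by
      rw [Real.rpow_neg (abs_nonneg t), ← sq_abs t]
      norm_cast
      exact inv_mul_cancel₀ (by positivity)
    calc _ ≤ 2 * (2 * Real.exp (-(1 / δ) ^ 2 / 3)) := by
          gcongr; exact min_le_left _ _
      _ = 0 + 4 * Real.exp (-(1 / δ) ^ 2 / 3) * (|t| ^ (-2 : ℝ) * t ^ 2) := by rw [h2]; ring
      _ ≤ δ ^ 2 * Real.exp (-(1 / 6) * t ^ 2) * t ^ 2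
          + 4 * Real.exp (-(1 / δ) ^ 2 / 3) * (|t| ^ (-2 : ℝ) * t ^ 2) := by gcongr; positivity
      _ = _ := by ring

/-- The budget 2δ is split into 1.2δ for the smoothing integral and 0.8δ for the Gaussian mass of an
interval of length 2δ, the density being at most 2/5. -/
lemma smoothing_constant_le (hδ : 0 < δ) (hδ2 : δ ≤ 1 / 2) :
    (δ ^ 2 * √(6 * Real.pi) + 8 * Real.exp (-(1 / δ) ^ 2 / 3) * δ) / (4 * Real.pi * δ)
      + 2 * δ * (2 / 5) ≤ 2 * δ := by
  -- After e^x ≥ 1 + x this is (1 - 2δ)(2 - 3δ) ≥ 0; the constant 6/7 makes the resulting inequality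
  -- an equality at δ = 1/2.
  have hE : Real.exp (-(1 / δ) ^ 2 / 3) ≤ 6 / 7 * δ := by
    have h1 : Real.exp (-(1 / δ) ^ 2 / 3) = (Real.exp (1 / (3 * δ ^ 2)))⁻¹ := by
      rw [← Real.exp_neg]; congr 1; field_simp
    rw [h1, inv_le_comm₀ (Real.exp_pos _) (by positivity)]
    refine le_trans ?_ (Real.add_one_le_exp _)
    rw [← one_div, div_le_iff₀ (by positivity)]
    have : (1 / (3 * δ ^ 2) + 1) * (6 / 7 * δ) = (1 + 3 * δ ^ 2) * 2 / (7 * δ) := by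
      field_simp; ring
    rw [this, le_div_iff₀ (by positivity)]
    nlinarith
  have hs : √(6 * Real.pi) ≤ 4.5 := by
    refine Real.sqrt_le_iff.2 ⟨by norm_num, ?_⟩
    have := Real.pi_lt_d2
    norm_num; linarith
  have hpi := Real.pi_gt_d2
  have h1 : (δ ^ 2 * √(6 * Real.pi) + 8 * Real.exp (-(1 / δ) ^ 2 / 3) * δ) / (4 * Real.pi * δ)
      ≤ 1.2 * δ := by
    rw [div_le_iff₀ (by positivity)]
    have a1 : δ ^ 2 * √(6 * Real.pi) ≤ δ ^ 2 * 4.5 := by gcongr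
    have a2 : 8 * Real.exp (-(1 / δ) ^ 2 / 3) * δ ≤ 8 * (6 / 7 * δ) * δ := by gcongr
    have a3 : 1.2 * δ * (4 * 3.14 * δ) ≤ 1.2 * δ * (4 * Real.pi * δ) := by gcongr
    nlinarith [sq_nonneg δ]
  linarith

lemma ramp_continuous (r ε : ℝ) : Continuous (ramp r ε) := by
  unfold ramp; fun_prop

lemma integrable_ramp (μ : Measure ℝ) [IsProbabilityMeasure μ] {ε : ℝ} (hε : 0 < ε) (r : ℝ) :
    Integrable (ramp r ε) μ := by
  refine (integrable_const (1 : ℝ)).mono' (ramp_continuous r ε).aestronglyMeasurable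
    (ae_of_all _ fun x => ?_)
  rw [Real.norm_of_nonneg (ramp_mem hε).1]
  exact (ramp_mem hε).2

lemma measureReal_Iio_le_integral_ramp (μ : Measure ℝ) [IsProbabilityMeasure μ] {ε : ℝ}
    (hε : 0 < ε) (r : ℝ) : μ.real (Iio r) ≤ ∫ u, ramp r ε u ∂μ := by
  rw [← integral_indicator_one measurableSet_Iio]
  refine integral_mono ((integrable_const 1).indicator measurableSet_Iio)
    (integrable_ramp μ hε r) fun u => ?_
  by_cases h : u ∈ Iio r
  · rw [indicator_of_mem h, ramp_eq_one hε (le_of_lt h)]; simp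
  · rw [indicator_of_notMem h]; exact (ramp_mem hε).1

lemma integral_ramp_le_measureReal_Iio (μ : Measure ℝ) [IsProbabilityMeasure μ] {ε : ℝ}
    (hε : 0 < ε) (r : ℝ) : ∫ u, ramp r ε u ∂μ ≤ μ.real (Iio (r + 2 * ε)) := by
  rw [← integral_indicator_one measurableSet_Iio]
  refine integral_mono (integrable_ramp μ hε r)
    ((integrable_const 1).indicator measurableSet_Iio) fun u => ?_
  by_cases h : u ∈ Iio (r + 2 * ε)
  · rw [indicator_of_mem h]; exact (ramp_mem hε).2
  · rw [indicator_of_notMem h, ramp_eq_zero hε (not_lt.1 h)]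

lemma gaussianReal_real_Iio_le (r : ℝ) {ε : ℝ} (hε : 0 < ε) :
    (gaussianReal 0 1).real (Iio (r + 2 * ε))
      ≤ (gaussianReal 0 1).real (Iio r) + 2 * ε * (2 / 5) := by
  have h : Iio (r + 2 * ε) ⊆ Iio r ∪ Icc r (r + 2 * ε) := by
    intro x hx
    rcases lt_or_ge x r with h | h
    · exact Or.inl h
    · exact Or.inr ⟨h, le_of_lt hx⟩
  have h2 := gaussianReal_real_Icc_le r (r + 2 * ε) (by linarith)
  have h3 := (measureReal_mono (μ := gaussianReal 0 1) h).trans (measureReal_union_le _ _)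
  linarith

/-- A Berry-Esseen bound for a probability measure whose characteristic function is the standard
Gaussian one up to a cubic error in the exponent and has modulus nonincreasing in `|t|`. -/
theorem abs_measureReal_Iio_sub_gaussian_le [IsProbabilityMeasure ν]
    (hint : Integrable id ν) (hδ : 0 < δ)
    (hδ2 : δ ≤ 1 / 2)
    (hR : ∀ t : ℝ, ∃ R : ℂ, ‖R‖ ≤ δ * |t| ^ 3 / 6 ∧
      charFun ν t = Complex.exp (-(t : ℂ) ^ 2 / 2 + R))
    (hanti : ∀ s t : ℝ, |s| ≤ |t| → ‖charFun ν t‖ ≤ ‖charFun ν s‖) (r : ℝ) :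
    |ν.real (Iio r) - (gaussianReal 0 1).real (Iio r)| ≤ 2 * δ := by
  have hg : Integrable id (gaussianReal 0 1) := (memLp_id_gaussianReal 1).integrable le_rfl
  have key : ∀ r, |∫ u, ramp r δ u ∂ν - ∫ u, ramp r δ u ∂(gaussianReal 0 1)|
      ≤ 2 * δ - 2 * δ * (2 / 5) := by
    intro r
    have := abs_integral_ramp_sub_le (r := r) hint hg hδ (integrable_smoothingMajorant hδ)
      (min_mul_norm_charFun_sub_le hδ hR hanti)
    rw [integral_smoothingMajorant hδ] at this
    linarith [smoothing_constant_le hδ hδ2]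
  have k1 := abs_le.1 (key r)
  -- The ramp at r dominates the indicator of (-∞, r) and gives the upper bound; the ramp at r - 2δ
  -- lies below it and gives the lower bound.
  have k2 := abs_le.1 (key (r - 2 * δ))
  have a1 := measureReal_Iio_le_integral_ramp ν hδ r
  have a2 := integral_ramp_le_measureReal_Iio (gaussianReal 0 1) hδ r
  have a3 := gaussianReal_real_Iio_le r hδ
  have b1 := integral_ramp_le_measureReal_Iio ν hδ (r - 2 * δ)
  have b2 := measureReal_Iio_le_integral_ramp (gaussianReal 0 1) hδ (r - 2 * δ)
  have b3 := gaussianReal_real_Iio_le (r - 2 * δ) hδ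
  rw [sub_add_cancel] at b1 b3
  rw [abs_le]
  constructor <;> linarith

end

/-! ### The distance from a uniform point to a subspace. -/

/-- The substitution x = r² in the Gamma integral. -/
lemma integral_pow_smul_cpow_mul_exp_neg_sq {d : ℕ} (hd : 0 < d) (s : ℝ) :
    ∫ r in Ioi (0 : ℝ), (r ^ (d - 1) : ℝ) •
        (((r : ℝ) : ℂ) ^ (s * Complex.I) * ((Real.exp (-r ^ 2) : ℝ) : ℂ))
      = Complex.Gamma ((d + s * Complex.I) / 2) / 2 := by
  have hre : 0 < ((d + s * Complex.I) / 2 : ℂ).re := by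
    simp [hd]
  have hsub := integral_comp_rpow_Ioi_of_pos (p := 2)
    (g := fun x : ℝ => ((Real.exp (-x) : ℝ) : ℂ) * (x : ℂ) ^ ((d + s * Complex.I) / 2 - 1 : ℂ))
    two_pos
  rw [Complex.Gamma_eq_integral hre, Complex.GammaIntegral, ← hsub, ← integral_div]
  refine setIntegral_congr_fun measurableSet_Ioi fun r hr => ?_
  have hr' : (0 : ℝ) < r := hr
  have hrc : (r : ℂ) ≠ 0 := by exact_mod_cast hr'.ne'
  have e1 : r ^ (2 - 1 : ℝ) = r := by norm_num
  have e2 : r ^ (2 : ℝ) = r ^ 2 := by norm_cast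
  have e3 : (((r ^ 2 : ℝ)) : ℂ) ^ ((d + s * Complex.I) / 2 - 1 : ℂ) * r
      = (r : ℂ) ^ (d - 1) * (r : ℂ) ^ (s * Complex.I) := by
    have : ((r ^ 2 : ℝ) : ℂ) = (r : ℂ) * (r : ℂ) := by push_cast; ring
    rw [this, Complex.mul_cpow_ofReal_nonneg hr'.le hr'.le, ← Complex.cpow_add _ _ hrc,
      ← Complex.cpow_natCast]
    nth_rewrite 2 [← Complex.cpow_one (r : ℂ)]
    rw [← Complex.cpow_add _ _ hrc, ← Complex.cpow_add _ _ hrc]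
    congr 1
    rw [Nat.cast_sub hd]
    push_cast
    ring
  simp only [e1, e2, Complex.real_smul]
  push_cast at e3 ⊢
  linear_combination (-Complex.exp (-(r : ℂ) ^ 2)) * e3

section
variable {E : Type*} [NormedAddCommGroup E] [InnerProductSpace ℝ E] [FiniteDimensional ℝ E]

/-- The norm of the component of `x` orthogonal to `V`. -/
def orthNorm (V : Submodule ℝ E) (x : E) : ℝ := ‖Vᗮ.orthogonalProjectionOnto x‖

lemma orthNorm_nonneg (V : Submodule ℝ E) (x : E) : 0 ≤ orthNorm V x := norm_nonneg _

lemma orthNorm_smul (V : Submodule ℝ E) {r : ℝ} (hr : 0 ≤ r) (x : E) :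
    orthNorm V (r • x) = orthNorm V x * r := by
  rw [orthNorm, map_smul, norm_smul, Real.norm_of_nonneg hr, mul_comm, orthNorm]

end

section
variable {E : Type*} [NormedAddCommGroup E] [InnerProductSpace ℝ E] [FiniteDimensional ℝ E]
  [MeasurableSpace E] [BorelSpace E]

lemma integral_norm_cpow_mul_exp_neg_sq [Nontrivial E] (s : ℝ) :
    ∫ x : E, ((‖x‖ : ℝ) : ℂ) ^ (s * Complex.I) * ((Real.exp (-‖x‖ ^ 2) : ℝ) : ℂ)
      = ((Module.finrank ℝ E * (volume : Measure E).real (Metric.ball 0 1) / 2 : ℝ) : ℂ)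
        * Complex.Gamma ((Module.finrank ℝ E + s * Complex.I) / 2) := by
  rw [integral_fun_norm_addHaar (volume : Measure E)
    (fun r : ℝ => ((r : ℝ) : ℂ) ^ (s * Complex.I) * ((Real.exp (-r ^ 2) : ℝ) : ℂ)),
    integral_pow_smul_cpow_mul_exp_neg_sq Module.finrank_pos]
  simp only [nsmul_eq_mul, Complex.real_smul]
  push_cast
  ring

lemma integral_eq_toSphere_mul [Nontrivial E] (g : E → ℂ) (h : ℝ → ℂ) (f : E → ℂ)
    (hf : ∀ (θ : Metric.sphere (0 : E) 1) (r : ℝ), 0 < r → f (r • (θ : E)) = g θ * h r) :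
    ∫ x : E, f x = (∫ θ : Metric.sphere (0 : E) 1, g θ ∂(volume : Measure E).toSphere) *
      ∫ r in Ioi (0 : ℝ), (r ^ (Module.finrank ℝ E - 1) : ℝ) • h r := by
  set d := Module.finrank ℝ E
  calc ∫ x : E, f x = ∫ x : ({(0)}ᶜ : Set E), f x.1 ∂((volume : Measure E).comap (↑)) := by
        rw [integral_subtype_comap (measurableSet_singleton _).compl f, restrict_compl_singleton]
    _ = ∫ z, g z.1 * h z.2 ∂(volume : Measure E).toSphere.prod (.volumeIoiPow (d - 1)) := by
        rw [← (volume : Measure E).measurePreserving_homeomorphUnitSphereProd.integral_comp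
          (Homeomorph.measurableEmbedding _)]
        congr 1 with x
        rw [← hf _ _ (homeomorphUnitSphereProd E x).2.2]
        congr 1
        conv_lhs => rw [← (homeomorphUnitSphereProd E).symm_apply_apply x]
        have hx : ‖(x : E)‖ ≠ 0 := norm_ne_zero_iff.2 x.2
        simp [homeomorphUnitSphereProd, smul_smul, hx]
    _ = (∫ θ : Metric.sphere (0 : E) 1, g θ ∂(volume : Measure E).toSphere) *
          ∫ r : Ioi (0 : ℝ), h r ∂.volumeIoiPow (d - 1) :=
        integral_prod_mul (fun θ : Metric.sphere (0 : E) 1 => g θ) (fun r : Ioi (0 : ℝ) => h r)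
    _ = _ := by
        congr 1
        simp only [Measure.volumeIoiPow, ENNReal.ofReal]
        rw [integral_withDensity_eq_integral_smul,
          integral_subtype_comap measurableSet_Ioi fun a ↦ Real.toNNReal (a ^ (d - 1)) • h a,
          setIntegral_congr_fun measurableSet_Ioi fun x hx ↦ ?_]
        · rw [NNReal.smul_def, Real.coe_toNNReal _ (pow_nonneg hx.out.le _)]
        · exact (measurable_subtype_coe.pow_const _).real_toNNReal

lemma integral_orthNorm_cpow_eq_toSphere [Nontrivial E] (V : Submodule ℝ E) (s : ℝ) :
    ∫ x : E, ((orthNorm V x : ℝ) : ℂ) ^ (s * Complex.I) * ((Real.exp (-‖x‖ ^ 2) : ℝ) : ℂ)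
      = (∫ θ : Metric.sphere (0 : E) 1, ((orthNorm V θ : ℝ) : ℂ) ^ (s * Complex.I)
          ∂(volume : Measure E).toSphere)
        * (Complex.Gamma ((Module.finrank ℝ E + s * Complex.I) / 2) / 2) := by
  rw [← integral_pow_smul_cpow_mul_exp_neg_sq Module.finrank_pos]
  refine integral_eq_toSphere_mul (fun x => ((orthNorm V x : ℝ) : ℂ) ^ (s * Complex.I)) _ _
    fun θ r hr => ?_
  have hθ : ‖(θ : E)‖ = 1 := by simp
  rw [orthNorm_smul V hr.le, norm_smul, hθ, mul_one, Real.norm_of_nonneg hr.le]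
  rw [Complex.ofReal_mul, Complex.mul_cpow_ofReal_nonneg (orthNorm_nonneg V _) hr.le]
  ring

lemma integral_orthNorm_cpow_eq_prod (V : Submodule ℝ E) (s : ℝ) :
    ∫ x : E, ((orthNorm V x : ℝ) : ℂ) ^ (s * Complex.I) * ((Real.exp (-‖x‖ ^ 2) : ℝ) : ℂ)
      = (∫ v : V, ((Real.exp (-‖v‖ ^ 2) : ℝ) : ℂ)) *
        ∫ w : Vᗮ, ((‖w‖ : ℝ) : ℂ) ^ (s * Complex.I) * ((Real.exp (-‖w‖ ^ 2) : ℝ) : ℂ) := by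
  let e : E ≃ᵐ V × Vᗮ := V.orthogonalDecomposition.toHomeomorph.toMeasurableEquiv.trans
    (MeasurableEquiv.toLp 2 _).symm
  have he : ∀ x, e x = (V.orthogonalProjectionOnto x, Vᗮ.orthogonalProjectionOnto x) := by
    intro x
    simp [e]
  have hmp : MeasurePreserving e :=
    (WithLp.volume_preserving_ofLp V Vᗮ).comp V.orthogonalDecomposition.measurePreserving
  rw [← integral_prod_mul, ← Measure.volume_eq_prod, ← hmp.integral_comp']
  congr 1 with x
  have hnorm : ‖x‖ ^ 2 = ‖V.orthogonalProjectionOnto x‖ ^ 2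
      + ‖Vᗮ.orthogonalProjectionOnto x‖ ^ 2 := by
    have := WithLp.prod_norm_sq_eq_of_L2 (V.orthogonalDecomposition x)
    rw [V.orthogonalDecomposition.norm_map] at this
    simpa using this
  rw [he, hnorm, neg_add, Real.exp_add, orthNorm]
  push_cast
  ring

/-- The Gaussian integral of the is-th power of the distance to V is computed twice: in polar
coordinates, and along the splitting V ⊕ Vᗮ, where only the norm in Vᗮ enters. Dividing by the same
identity at s = 0 removes the unknown constants. -/
lemma integral_orthNorm_cpow_toSphere [Nontrivial E] (V : Submodule ℝ E) [Nontrivial Vᗮ] (s : ℝ) :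
    ∫ θ : Metric.sphere (0 : E) 1, ((orthNorm V θ : ℝ) : ℂ) ^ (s * Complex.I)
        ∂(volume : Measure E).toSphere
      = (volume : Measure E).toSphere.real univ *
        (Complex.Gamma ((Module.finrank ℝ Vᗮ + s * Complex.I) / 2) *
          Complex.Gamma (Module.finrank ℝ E / 2) /
          (Complex.Gamma (Module.finrank ℝ Vᗮ / 2) *
            Complex.Gamma ((Module.finrank ℝ E + s * Complex.I) / 2))) := by
  have hne : ∀ (d : ℕ) (t : ℝ), 0 < d → Complex.Gamma ((d + t * Complex.I) / 2) ≠ 0 := by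
    intro d t hd
    exact Complex.Gamma_ne_zero_of_re_pos (by simp [hd])
  have h : ∀ t : ℝ, _ := fun t => (integral_orthNorm_cpow_eq_toSphere V t).symm.trans
    ((integral_orthNorm_cpow_eq_prod V t).trans
      (congrArg _ (integral_norm_cpow_mul_exp_neg_sq (E := Vᗮ) t)))
  have hs := h s
  have h0 := h 0
  have n1 := hne (Module.finrank ℝ E) s Module.finrank_pos
  have n2 := hne (Module.finrank ℝ Vᗮ) 0 Module.finrank_pos
  have n3 := hne (Module.finrank ℝ E) 0 Module.finrank_pos
  simp only [Complex.ofReal_zero, zero_mul, Complex.cpow_zero, add_zero, integral_const,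
    Complex.real_smul, mul_one] at h0 n2 n3
  rw [← mul_div_assoc, eq_div_iff (mul_ne_zero n2 n1)]
  linear_combination (2 * Complex.Gamma (Module.finrank ℝ Vᗮ / 2)) * hs
    - (2 * Complex.Gamma ((Module.finrank ℝ Vᗮ + s * Complex.I) / 2)) * h0

end

instance isProbabilityMeasure_uniformSphere (n : ℕ) [NeZero n] :
    IsProbabilityMeasure (uniformSphere n) := by
  have : Nontrivial (EuclideanSpace ℝ (Fin n)) :=
    Module.nontrivial_of_finrank_pos (R := ℝ) (by simpa using NeZero.pos n)
  have hne : NeZero (volume : Measure (EuclideanSpace ℝ (Fin n))).toSphere :=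
    ⟨Measure.toSphere_ne_zero _⟩
  unfold uniformSphere
  infer_instance

lemma integral_orthNorm_cpow_uniformSphere {n : ℕ} (V : Submodule ℝ (EuclideanSpace ℝ (Fin n)))
    (hV : Module.finrank ℝ V < n) (s : ℝ) :
    ∫ θ, ((orthNorm V θ : ℝ) : ℂ) ^ (s * Complex.I) ∂(uniformSphere n)
      = Complex.Gamma (((n - Module.finrank ℝ V : ℕ) + s * Complex.I) / 2) *
          Complex.Gamma (n / 2) /
          (Complex.Gamma ((n - Module.finrank ℝ V : ℕ) / 2) *
            Complex.Gamma ((n + s * Complex.I) / 2)) := by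
  have h1 : Module.finrank ℝ (EuclideanSpace ℝ (Fin n)) = n := by simp
  have : Nontrivial (EuclideanSpace ℝ (Fin n)) :=
    Module.nontrivial_of_finrank_pos (R := ℝ) (by omega)
  have h2 : Module.finrank ℝ Vᗮ = n - Module.finrank ℝ V := by
    have := V.finrank_add_finrank_orthogonal
    omega
  have : Nontrivial Vᗮ := Module.nontrivial_of_finrank_pos (R := ℝ) (by omega)
  have hm : (volume : Measure (EuclideanSpace ℝ (Fin n))).toSphere.real univ ≠ 0 := by
    rw [measureReal_def, ENNReal.toReal_ne_zero]
    exact ⟨Measure.measure_univ_ne_zero.2 (Measure.toSphere_ne_zero _), measure_ne_top _ _⟩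
  rw [uniformSphere, integral_smul_measure, integral_orthNorm_cpow_toSphere, h1, h2,
    ENNReal.toReal_inv, ← measureReal_def, Complex.real_smul, ← mul_assoc, Complex.ofReal_inv,
    inv_mul_cancel₀ (by exact_mod_cast hm), one_mul]

lemma uniformSphere_submodule_null {n : ℕ} (V : Submodule ℝ (EuclideanSpace ℝ (Fin n)))
    (hV : Module.finrank ℝ V < n) :
    uniformSphere n {θ | (θ : EuclideanSpace ℝ (Fin n)) ∈ V} = 0 := by
  have hVm : MeasurableSet (V : Set (EuclideanSpace ℝ (Fin n))) :=
    V.closed_of_finiteDimensional.measurableSet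
  have hVtop : V ≠ ⊤ := by
    rintro rfl
    simp at hV
  have h0 : (volume : Measure (EuclideanSpace ℝ (Fin n))) V = 0 :=
    Measure.addHaar_submodule _ V hVtop
  have : (volume : Measure (EuclideanSpace ℝ (Fin n))).toSphere
      {θ | (θ : EuclideanSpace ℝ (Fin n)) ∈ V} = 0 := by
    rw [Measure.toSphere_apply' _
      (show MeasurableSet {θ : Metric.sphere (0 : EuclideanSpace ℝ (Fin n)) 1 |
      (θ : EuclideanSpace ℝ (Fin n)) ∈ V} from measurable_subtype_coe hVm)]
    refine mul_eq_zero.2 (Or.inr (measure_mono_null ?_ h0))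
    rintro _ ⟨r, -, _, ⟨θ, hθ, rfl⟩, rfl⟩
    exact V.smul_mem r hθ
  rw [uniformSphere, Measure.smul_apply, this, smul_zero]

/-! ### Gram-Schmidt volume. -/

section
variable {E : Type*} [NormedAddCommGroup E] [InnerProductSpace ℝ E]

/-- The product of the norms of the Gram-Schmidt vectors of a family: the volume of the
parallelepiped it spans. -/
def gramSchmidtVolume {p : ℕ} (y : Fin p → E) : ℝ := ∏ i, ‖gramSchmidt ℝ y i‖

lemma gramSchmidtVolume_nonneg {p : ℕ} (y : Fin p → E) : 0 ≤ gramSchmidtVolume y :=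
  Finset.prod_nonneg fun _ _ => norm_nonneg _

/-- Nonzero orthogonal vectors are independent, and Gram-Schmidt preserves the span, so the
dimension count transfers to the original family. -/
lemma linearIndependent_of_gramSchmidtVolume_ne_zero {p : ℕ} {y : Fin p → E}
    (h : gramSchmidtVolume y ≠ 0) : LinearIndependent ℝ y := by
  have h0 : ∀ i, gramSchmidt ℝ y i ≠ 0 := by
    intro i hi
    exact h (Finset.prod_eq_zero (Finset.mem_univ i) (by rw [hi, norm_zero]))
  have h1 : LinearIndependent ℝ (gramSchmidt ℝ y) :=
    linearIndependent_of_ne_zero_of_inner_eq_zero h0 (gramSchmidt_pairwise_orthogonal ℝ y)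
  rw [linearIndependent_iff_card_eq_finrank_span, Set.finrank, ← span_gramSchmidt ℝ y]
  exact linearIndependent_iff_card_eq_finrank_span.1 h1

variable [FiniteDimensional ℝ E]

lemma norm_gramSchmidt_eq_orthNorm {p : ℕ} (y : Fin p → E) (i : Fin p) :
    ‖gramSchmidt ℝ y i‖ = orthNorm (Submodule.span ℝ (y '' Iio i)) (y i) := by
  set W := Submodule.span ℝ (y '' Iio i)
  have hW : W = Submodule.span ℝ (gramSchmidt ℝ y '' Iio i) := (span_gramSchmidt_Iio ℝ y i).symm
  have h1 : gramSchmidt ℝ y i ∈ Wᗮ := by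
    rw [hW, Submodule.mem_orthogonal]
    intro u hu
    induction hu using Submodule.span_induction with
    | mem x hx =>
      obtain ⟨j, hj, rfl⟩ := hx
      exact gramSchmidt_orthogonal ℝ y (ne_of_lt hj)
    | zero => simp
    | add a b _ _ ha hb => rw [inner_add_left, ha, hb, add_zero]
    | smul c a _ ha => rw [inner_smul_left, ha, mul_zero]
  have h2 : y i - gramSchmidt ℝ y i ∈ W := by
    rw [gramSchmidt_def, sub_sub_cancel, hW]
    refine Submodule.sum_mem _ fun j hj => ?_
    have hle : Submodule.span ℝ {gramSchmidt ℝ y j} ≤ Submodule.span ℝ (gramSchmidt ℝ y '' Iio i) :=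
      Submodule.span_mono (singleton_subset_iff.2 (mem_image_of_mem _ (Finset.mem_Iio.1 hj)))
    exact hle (Submodule.starProjection_apply_mem _ _)
  have h3 : Wᗮ.orthogonalProjectionOnto (y i)
      = Wᗮ.orthogonalProjectionOnto (gramSchmidt ℝ y i) := by
    rw [← sub_eq_zero, ← map_sub]
    exact Submodule.orthogonalProjectionOnto_orthogonal_apply_eq_zero h2
  rw [orthNorm, h3]
  have h4 : ((Wᗮ.orthogonalProjectionOnto (gramSchmidt ℝ y i) : Wᗮ) : E) = gramSchmidt ℝ y i := by
    exact congrArg Subtype.val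
      (Submodule.orthogonalProjectionOnto_mem_subspace_eq_self (⟨_, h1⟩ : Wᗮ))
  exact (congrArg norm h4).symm

lemma gramSchmidtVolume_succ {p : ℕ} (y : Fin (p + 1) → E) :
    gramSchmidtVolume y = gramSchmidtVolume (fun i : Fin p => y i.castSucc) *
      orthNorm (Submodule.span ℝ (range fun i : Fin p => y i.castSucc)) (y (Fin.last p)) := by
  unfold gramSchmidtVolume
  simp_rw [norm_gramSchmidt_eq_orthNorm]
  rw [Fin.prod_univ_castSucc]
  congr 1
  · refine Finset.prod_congr rfl fun i _ => ?_
    congr 2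
    ext x
    constructor
    · rintro ⟨j, hj, rfl⟩
      exact ⟨⟨j, lt_trans hj i.2⟩, hj, rfl⟩
    · rintro ⟨j, hj, rfl⟩
      exact ⟨j.castSucc, hj, rfl⟩
  · congr 2
    ext x
    constructor
    · rintro ⟨j, hj, rfl⟩
      exact ⟨⟨j, hj⟩, rfl⟩
    · rintro ⟨j, rfl⟩
      exact ⟨j.castSucc, Fin.castSucc_lt_last j, rfl⟩

lemma orthNorm_eq_zero_iff {V : Submodule ℝ E} {x : E} : orthNorm V x = 0 ↔ x ∈ V := by
  rw [orthNorm, norm_eq_zero, Submodule.orthogonalProjectionOnto_eq_zero_iff,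
    Submodule.orthogonal_orthogonal]

lemma measurable_gramSchmidt [MeasurableSpace E] [BorelSpace E] {p : ℕ} (i : Fin p) :
    Measurable fun y : Fin p → E => gramSchmidt ℝ y i := by
  induction i using WellFoundedLT.induction with
  | ind i ih =>
    have h : ∀ y : Fin p → E, gramSchmidt ℝ y i = y i - ∑ j ∈ Finset.Iio i,
        (inner ℝ (gramSchmidt ℝ y j) (y i) / ‖gramSchmidt ℝ y j‖ ^ 2) • gramSchmidt ℝ y j := by
      intro y
      rw [gramSchmidt_def]
      simp_rw [Submodule.starProjection_singleton]
      rfl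
    simp_rw [h]
    refine (measurable_pi_apply i).sub (Finset.measurable_sum _ fun j hj => ?_)
    have hj' := ih j (Finset.mem_Iio.1 hj)
    exact ((hj'.inner (measurable_pi_apply i)).div (hj'.norm.pow_const 2)).smul hj'

lemma measurable_gramSchmidtVolume [MeasurableSpace E] [BorelSpace E] (p : ℕ) :
    Measurable (gramSchmidtVolume : (Fin p → E) → ℝ) :=
  Finset.measurable_prod _ fun i _ => (measurable_gramSchmidt i).norm

end

/-! ### The characteristic function of the log-volume. -/

/-- The characteristic function of the logarithm of the distance of a uniform point on the sphere
`S^{n-1}` to a `k`-dimensional subspace. -/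
def logDistCharFun (n k : ℕ) (s : ℝ) : ℂ :=
  Complex.Gamma (((n - k : ℕ) + s * Complex.I) / 2) * Complex.Gamma (n / 2) /
    (Complex.Gamma ((n - k : ℕ) / 2) * Complex.Gamma ((n + s * Complex.I) / 2))

lemma norm_ofReal_cpow_mul_I_le {x : ℝ} (hx : 0 ≤ x) (s : ℝ) :
    ‖(x : ℂ) ^ (s * Complex.I)‖ ≤ 1 := by
  rcases hx.eq_or_lt with rfl | hx
  · by_cases h : (s * Complex.I : ℂ) = 0
    · rw [h, Complex.cpow_zero, norm_one]
    · rw [Complex.ofReal_zero, Complex.zero_cpow h, norm_zero]; exact zero_le_one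
  · rw [Complex.norm_cpow_eq_rpow_re_of_pos hx]; simp

/-- The joint law of `p` independent uniform points on the sphere. -/
abbrev sphereProduct (n p : ℕ) :
    Measure (Fin p → Metric.sphere (0 : EuclideanSpace ℝ (Fin n)) 1) :=
  Measure.pi fun _ => uniformSphere n

/-- The volume of the parallelepiped spanned by `p` points on the sphere. -/
def sphereVolume {n p : ℕ} (y : Fin p → Metric.sphere (0 : EuclideanSpace ℝ (Fin n)) 1) : ℝ :=
  gramSchmidtVolume fun i => (y i : EuclideanSpace ℝ (Fin n))

lemma sphereVolume_nonneg {n p : ℕ}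
    (y : Fin p → Metric.sphere (0 : EuclideanSpace ℝ (Fin n)) 1) : 0 ≤ sphereVolume y :=
  gramSchmidtVolume_nonneg _

lemma measurable_sphereVolume (n p : ℕ) : Measurable (sphereVolume (n := n) (p := p)) :=
  (measurable_gramSchmidtVolume p).comp
    (measurable_pi_iff.2 fun i => measurable_subtype_coe.comp (measurable_pi_apply i))

section
variable {n p : ℕ}

/-- Splitting off the last point of a family of points on the sphere. -/
abbrev splitLast (n p : ℕ) := MeasurableEquiv.piFinSuccAbove
  (fun _ : Fin (p + 1) => Metric.sphere (0 : EuclideanSpace ℝ (Fin n)) 1) (Fin.last p)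

lemma measurePreserving_splitLast [NeZero n] :
    MeasurePreserving (splitLast n p).symm ((uniformSphere n).prod (sphereProduct n p))
      (sphereProduct n (p + 1)) :=
  (measurePreserving_piFinSuccAbove (fun _ => uniformSphere n) (Fin.last p)).symm

lemma sphereVolume_splitLast_symm
    (z : Metric.sphere (0 : EuclideanSpace ℝ (Fin n)) 1 ×
      (Fin p → Metric.sphere (0 : EuclideanSpace ℝ (Fin n)) 1)) :
    sphereVolume ((splitLast n p).symm z) = sphereVolume z.2 *
      orthNorm (Submodule.span ℝ (range fun i => (z.2 i : EuclideanSpace ℝ (Fin n)))) z.1 := by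
  rw [sphereVolume, gramSchmidtVolume_succ]
  simp [sphereVolume]

lemma finrank_span_of_sphereVolume_ne_zero
    {y : Fin p → Metric.sphere (0 : EuclideanSpace ℝ (Fin n)) 1} (h : sphereVolume y ≠ 0) :
    Module.finrank ℝ (Submodule.span ℝ (range fun i => (y i : EuclideanSpace ℝ (Fin n)))) = p := by
  have := linearIndependent_iff_card_eq_finrank_span.1
    (linearIndependent_of_gramSchmidtVolume_ne_zero h)
  simpa [Set.finrank] using this.symm

/-- By Fubini and induction: the earlier points span a proper subspace, which the last point almost
surely avoids. -/
lemma ae_sphereVolume_ne_zero [NeZero n] (hpn : p ≤ n) :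
    ∀ᵐ y ∂(sphereProduct n p), sphereVolume y ≠ 0 := by
  induction p with
  | zero => exact ae_of_all _ fun y => by simp [sphereVolume, gramSchmidtVolume]
  | succ p ih =>
    have ih := ih (by omega)
    have hm : MeasurableSet {y : Fin (p + 1) → Metric.sphere (0 : EuclideanSpace ℝ (Fin n)) 1 |
        sphereVolume y = 0} := measurable_sphereVolume n (p + 1) (measurableSet_singleton 0)
    have hm2 := (splitLast n p).symm.measurable hm
    rw [ae_iff]
    simp only [ne_eq, not_not]
    rw [← measurePreserving_splitLast.measure_preimage hm.nullMeasurableSet,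
      Measure.prod_apply_symm hm2]
    refine lintegral_eq_zero_of_ae_eq_zero ?_
    filter_upwards [ih] with y hy
    refine measure_mono_null ?_ (uniformSphere_submodule_null (n := n)
      (Submodule.span ℝ (range fun i => (y i : EuclideanSpace ℝ (Fin n))))
      (by rw [finrank_span_of_sphereVolume_ne_zero hy]; omega))
    intro θ hθ
    have h1 : sphereVolume ((splitLast n p).symm (θ, y)) = 0 := hθ
    rw [sphereVolume_splitLast_symm] at h1
    exact orthNorm_eq_zero_iff.1 ((mul_eq_zero.1 h1).resolve_left hy)

lemma integral_sphereVolume_cpow [NeZero n] (hpn : p ≤ n) (s : ℝ) :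
    ∫ y, ((sphereVolume y : ℝ) : ℂ) ^ (s * Complex.I) ∂(sphereProduct n p)
      = ∏ k ∈ Finset.range p, logDistCharFun n k s := by
  induction p with
  | zero => simp [sphereVolume, gramSchmidtVolume]
  | succ p ih =>
    have ih := ih (by omega)
    have hmeas : Measurable fun y : Fin (p + 1) → Metric.sphere (0 : EuclideanSpace ℝ (Fin n)) 1 =>
        ((sphereVolume y : ℝ) : ℂ) ^ (s * Complex.I) :=
      (Complex.measurable_ofReal.comp (measurable_sphereVolume n (p + 1))).pow_const _
    have hint : Integrable (fun z => ((sphereVolume ((splitLast n p).symm z) : ℝ) : ℂ)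
        ^ (s * Complex.I)) ((uniformSphere n).prod (sphereProduct n p)) :=
      (integrable_const (1 : ℝ)).mono'
        (hmeas.comp (splitLast n p).symm.measurable).aestronglyMeasurable
        (ae_of_all _ fun z => norm_ofReal_cpow_mul_I_le (sphereVolume_nonneg _) s)
    rw [← measurePreserving_splitLast.integral_comp', integral_prod_symm _ hint,
      Finset.prod_range_succ, ← ih, ← integral_mul_const]
    refine integral_congr_ae ?_
    -- For almost all earlier points the span has dimension exactly p, so the integral over the last
    -- point does not depend on them and factors out.
    filter_upwards [ae_sphereVolume_ne_zero (n := n) (p := p) (by omega)] with y hy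
    have hfr := finrank_span_of_sphereVolume_ne_zero hy
    have h1 : ∀ θ : Metric.sphere (0 : EuclideanSpace ℝ (Fin n)) 1,
        ((sphereVolume ((splitLast n p).symm (θ, y)) : ℝ) : ℂ) ^ (s * Complex.I)
        = ((sphereVolume y : ℝ) : ℂ) ^ (s * Complex.I) *
          ((orthNorm (Submodule.span ℝ
            (range fun i => (y i : EuclideanSpace ℝ (Fin n)))) θ : ℝ) : ℂ)
            ^ (s * Complex.I) := by
      intro θ
      rw [sphereVolume_splitLast_symm, Complex.ofReal_mul,
        Complex.mul_cpow_ofReal_nonneg (sphereVolume_nonneg y) (orthNorm_nonneg _ _)]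
    simp_rw [h1]
    rw [integral_const_mul, integral_orthNorm_cpow_uniformSphere _ (by rw [hfr]; omega), hfr]
    rfl

lemma charFun_log_sphereVolume [NeZero n] (hpn : p ≤ n) (s : ℝ) :
    charFun ((sphereProduct n p).map fun y => Real.log (sphereVolume y)) s
      = ∏ k ∈ Finset.range p, logDistCharFun n k s := by
  rw [← integral_sphereVolume_cpow hpn, charFun_apply_real,
    integral_map (measurable_sphereVolume n p).log.aemeasurable
      (Continuous.aestronglyMeasurable (by fun_prop))]
  refine integral_congr_ae ?_
  filter_upwards [ae_sphereVolume_ne_zero (n := n) (p := p) hpn] with y hy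
  rw [Complex.cpow_def_of_ne_zero (by exact_mod_cast hy),
    Complex.ofReal_log (sphereVolume_nonneg y)]
  ring_nf

end

/-! ### From the simplex to the parallelepiped. -/

/-- The standard simplex with vertices the origin and the standard basis vectors. -/
def cornerSimplex (p : ℕ) : Set (EuclideanSpace ℝ (Fin p)) :=
  {x | (∀ i, 0 ≤ x i) ∧ ∑ i, x i ≤ 1}

lemma volume_cornerSimplex_ne_top (p : ℕ) : volume (cornerSimplex p) ≠ ∞ := by
  refine ne_top_of_le_ne_top (measure_closedBall_lt_top
    (μ := (volume : Measure (EuclideanSpace ℝ (Fin p)))) (x := 0) (r := 1)).ne (measure_mono ?_)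
  rintro x ⟨h0, h1⟩
  rw [mem_closedBall_zero_iff, EuclideanSpace.norm_eq, Real.sqrt_le_left (by norm_num), one_pow]
  refine le_trans (Finset.sum_le_sum fun i _ => ?_) h1
  have : x i ≤ 1 := (Finset.single_le_sum (fun j _ => h0 j) (Finset.mem_univ i)).trans h1
  rw [Real.norm_of_nonneg (h0 i)]
  nlinarith [h0 i]

/-- Positivity and finiteness suffice: the logarithm of this volume is only a shift, so the value
1/p! is never needed. -/
lemma volume_cornerSimplex_ne_zero (p : ℕ) : volume (cornerSimplex p) ≠ 0 := by
  have ho : IsOpen {x : EuclideanSpace ℝ (Fin p) | (∀ i, 0 < x i) ∧ ∑ i, x i < 1} := by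
    refine IsOpen.and ?_ (isOpen_lt (by fun_prop) continuous_const)
    simp only [Set.ofPred_forall]
    exact isOpen_iInter_of_finite fun i => isOpen_lt continuous_const (by fun_prop)
  have hne : {x : EuclideanSpace ℝ (Fin p) | (∀ i, 0 < x i) ∧ ∑ i, x i < 1}.Nonempty := by
    refine ⟨WithLp.toLp 2 fun _ => 1 / ((p : ℝ) + 1), fun i => ?_, ?_⟩
    · simp only; positivity
    · simp only [Finset.sum_const, Finset.card_univ, Fintype.card_fin, nsmul_eq_mul]
      rw [mul_one_div, div_lt_one (by positivity)]
      linarith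
  have hsub : {x : EuclideanSpace ℝ (Fin p) | (∀ i, 0 < x i) ∧ ∑ i, x i < 1} ⊆ cornerSimplex p :=
    fun x hx => ⟨fun i => (hx.1 i).le, hx.2.le⟩
  exact fun h => (ho.measure_pos volume hne).ne' (measure_mono_null hsub h)

section
variable {n p : ℕ} (y : Fin p → EuclideanSpace ℝ (Fin n))

/-- The coefficients of a family in its Gram-Schmidt orthonormalization. -/
def gramSchmidtMatrix : Matrix (Fin p) (Fin p) ℝ := fun i j =>
  if j = i then ‖gramSchmidt ℝ y i‖
  else if j < i then inner ℝ (gramSchmidt ℝ y j) (y i) / ‖gramSchmidt ℝ y j‖ else 0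

lemma det_gramSchmidtMatrix : (gramSchmidtMatrix y).det = gramSchmidtVolume y := by
  rw [Matrix.det_of_isLowerTriangular]
  · simp [gramSchmidtMatrix, gramSchmidtVolume]
  · intro i j hij
    have hij' : i < j := hij
    simp [gramSchmidtMatrix, hij'.ne', hij'.not_gt]

variable {y}

lemma sum_gramSchmidtMatrix_smul (hy : LinearIndependent ℝ y) (i : Fin p) :
    ∑ j, gramSchmidtMatrix y i j • gramSchmidtNormed ℝ y j = y i := by
  have h0 : ∀ j, ‖gramSchmidt ℝ y j‖ ≠ 0 := fun j => norm_ne_zero_iff.2 (gramSchmidt_ne_zero j hy)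
  conv_rhs => rw [gramSchmidt_def'' ℝ y i]
  have hterm : ∀ j, gramSchmidtMatrix y i j • gramSchmidtNormed ℝ y j
      = (if j = i then gramSchmidt ℝ y i else 0) + if j ∈ Finset.Iio i then
        (inner ℝ (gramSchmidt ℝ y j) (y i) / ‖gramSchmidt ℝ y j‖ ^ 2) • gramSchmidt ℝ y j
        else 0 := by
    intro j
    simp only [gramSchmidtMatrix, gramSchmidtNormed, smul_smul, Finset.mem_Iio]
    split_ifs with h1 h2 h2
    · exact absurd h2 (by simp [h1])
    · subst h1; simp [h0]
    · rw [zero_add]; congr 1; simp; field_simp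
    · simp
  simp_rw [hterm, Finset.sum_add_distrib]
  congr 1
  · simp
  · rw [Finset.sum_ite_mem, Finset.univ_inter]
    rfl

/-- The simplex is the image of the corner simplex under the triangular Gram-Schmidt matrix, which
scales volume by the product of its diagonal, followed by an isometric embedding, which preserves
Hausdorff measure. -/
lemma simplexVolume_eq (hy : LinearIndependent ℝ y) :
    simplexVolume y = gramSchmidtVolume y * volume.real (cornerSimplex p) := by
  have hon : Orthonormal ℝ (gramSchmidtNormed ℝ y) := gramSchmidtNormed_orthonormal hy
  let J : EuclideanSpace ℝ (Fin p) →ₗ[ℝ] EuclideanSpace ℝ (Fin n) :=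
    { toFun := fun x => ∑ j, x j • gramSchmidtNormed ℝ y j
      map_add' := fun a b => by simp [add_smul, Finset.sum_add_distrib]
      map_smul' := fun c a => by simp [Finset.smul_sum, smul_smul] }
  have hJ : Isometry J := by
    refine AddMonoidHomClass.isometry_of_norm J fun x => ?_
    have h1 : ‖J x‖ ^ 2 = ‖x‖ ^ 2 := by
      rw [← real_inner_self_eq_norm_sq, EuclideanSpace.real_norm_sq_eq]
      simp only [J, LinearMap.coe_mk, AddHom.coe_mk]
      rw [hon.inner_sum]
      simp [sq]
    exact (sq_eq_sq₀ (norm_nonneg _) (norm_nonneg _)).1 h1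
  let b := (EuclideanSpace.basisFun (Fin p) ℝ).toBasis
  let A := Matrix.toLin b b (gramSchmidtMatrix y).transpose
  have hA : ∀ x j, A x j = ∑ i, x i * gramSchmidtMatrix y i j := by
    intro x j
    have : (b.repr (A x)) j = ∑ i, x i * gramSchmidtMatrix y i j := by
      rw [Matrix.repr_toLin]
      simp [Matrix.mulVec, dotProduct, b, mul_comm]
    simpa [b] using this
  have himage : originSimplex y = J '' (A '' cornerSimplex p) := by
    have hJA : ∀ x : EuclideanSpace ℝ (Fin p), J (A x) = ∑ i, x i • y i := by
      intro x
      simp only [J, LinearMap.coe_mk, AddHom.coe_mk, hA, Finset.sum_smul]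
      rw [Finset.sum_comm]
      refine Finset.sum_congr rfl fun i _ => ?_
      conv_rhs => rw [← sum_gramSchmidtMatrix_smul hy i]
      rw [Finset.smul_sum]
      simp [smul_smul]
    rw [image_image]
    ext z
    constructor
    · rintro ⟨s, h0, h1, rfl⟩
      exact ⟨WithLp.toLp 2 s, ⟨h0, h1⟩, hJA _⟩
    · rintro ⟨x, ⟨h0, h1⟩, rfl⟩
      exact ⟨x, h0, h1, hJA x⟩
  rw [simplexVolume, himage, measureReal_def, hJ.euclideanHausdorffMeasure_image,
    EuclideanSpace.euclideanHausdorffMeasure_eq_volume, Measure.addHaar_image_linearMap,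
    LinearMap.det_toLin, Matrix.det_transpose, det_gramSchmidtMatrix,
    abs_of_nonneg (gramSchmidtVolume_nonneg y), ENNReal.toReal_mul,
    ENNReal.toReal_ofReal (gramSchmidtVolume_nonneg y), measureReal_def]

end

/-! ### Gamma ratios as infinite products; monotonicity of the modulus. -/

/-- The characteristic function of the logarithm of a generic term in the product decomposition of
a beta random variable. -/
def gammaFactor (x y t : ℝ) : ℂ := (1 + t * Complex.I / y) / (1 + t * Complex.I / x)

lemma one_add_mul_I_div_ne_zero (x t : ℝ) : (1 + t * Complex.I / x : ℂ) ≠ 0 := by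
  intro h
  have h2 := congrArg Complex.re h
  have : (t * Complex.I / x : ℂ).re = 0 := by
    rw [Complex.div_ofReal_re]; simp
  rw [Complex.add_re, this] at h2
  simp at h2

lemma tendsto_prod_gammaFactor {n k : ℕ} (hk : k < n) (t : ℝ) :
    Tendsto (fun N => ∏ m ∈ Finset.range N, gammaFactor ((n - k : ℕ) + 2 * m) (n + 2 * m) t) atTop
      (𝓝 (logDistCharFun n k t)) := by
  -- The N-th term of `Complex.GammaSeq` has N + 1 factors in its denominator.
  rw [← tendsto_add_atTop_iff_nat 1]
  set j := n - k with hj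
  have hj0 : 0 < j := by omega
  have hn0 : 0 < n := by omega
  have hne : ∀ (d : ℕ) (t : ℝ), 0 < d → Complex.Gamma ((d + t * Complex.I) / 2) ≠ 0 := by
    intro d t hd
    exact Complex.Gamma_ne_zero_of_re_pos (by simp [hd])
  have hne' : ∀ (d : ℕ), 0 < d → Complex.Gamma (d / 2) ≠ 0 := by
    intro d hd
    exact Complex.Gamma_ne_zero_of_re_pos (by simp [hd])
  have hl := (((Complex.GammaSeq_tendsto_Gamma ((j + t * Complex.I) / 2)).mul
    (Complex.GammaSeq_tendsto_Gamma (n / 2))).div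
    ((Complex.GammaSeq_tendsto_Gamma (j / 2)).mul
      (Complex.GammaSeq_tendsto_Gamma ((n + t * Complex.I) / 2)))
    (mul_ne_zero (hne' j hj0) (hne n t hn0)))
  refine hl.congr' ?_
  filter_upwards [eventually_gt_atTop 0] with N hN
  have hNc : (N : ℂ) ≠ 0 := by exact_mod_cast hN.ne'
  have hfac : ((N.factorial : ℕ) : ℂ) ≠ 0 := by exact_mod_cast N.factorial_ne_zero
  -- The exponents balance across the four Gamma functions, so the powers of N cancel, as do the
  -- factorials.
  have hpow : (N : ℂ) ^ ((j + t * Complex.I) / 2) * (N : ℂ) ^ ((n : ℂ) / 2)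
      = (N : ℂ) ^ ((j : ℂ) / 2) * (N : ℂ) ^ ((n + t * Complex.I) / 2) := by
    rw [← Complex.cpow_add _ _ hNc, ← Complex.cpow_add _ _ hNc]; ring_nf
  have hp0 : ∀ z : ℂ, (N : ℂ) ^ z ≠ 0 := fun z => by
    rw [Complex.cpow_def_of_ne_zero hNc]; exact Complex.exp_ne_zero _
  have hsum : ∀ (d m : ℕ) (u : ℝ), 0 < d → ((d + u * Complex.I) / 2 + m : ℂ) ≠ 0 := by
    intro d m u hd h
    have h2 := congrArg Complex.re h
    simp at h2
    have : (0 : ℝ) < d := by exact_mod_cast hd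
    have : (0 : ℝ) ≤ m := by positivity
    linarith
  have hsum' : ∀ (d m : ℕ), 0 < d → ((d : ℂ) / 2 + m : ℂ) ≠ 0 := by
    intro d m hd
    simpa using hsum d m 0 hd
  have P : ∀ (d : ℕ) (u : ℝ), 0 < d →
      ∏ m ∈ Finset.range (N + 1), ((d + u * Complex.I) / 2 + m : ℂ) ≠ 0 :=
    fun d u hd => Finset.prod_ne_zero_iff.2 fun m _ => hsum d m u hd
  have P' : ∀ (d : ℕ), 0 < d →
      ∏ m ∈ Finset.range (N + 1), ((d : ℂ) / 2 + m : ℂ) ≠ 0 :=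
    fun d hd => Finset.prod_ne_zero_iff.2 fun m _ => hsum' d m hd
  have hprod : ∏ m ∈ Finset.range (N + 1), gammaFactor (j + 2 * m) (n + 2 * m) t
      = (∏ m ∈ Finset.range (N + 1), ((n + t * Complex.I) / 2 + m : ℂ))
        * (∏ m ∈ Finset.range (N + 1), ((j : ℂ) / 2 + m : ℂ))
        / ((∏ m ∈ Finset.range (N + 1), ((n : ℂ) / 2 + m : ℂ))
        * (∏ m ∈ Finset.range (N + 1), ((j + t * Complex.I) / 2 + m : ℂ))) := by
    rw [← Finset.prod_mul_distrib, ← Finset.prod_mul_distrib, ← Finset.prod_div_distrib]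
    refine Finset.prod_congr rfl fun m _ => ?_
    have a1 := hsum' n m hn0
    have a2 := hsum' j m hj0
    have a3 := hsum j m t hj0
    have b1 : ((n + 2 * m : ℝ) : ℂ) = 2 * ((n : ℂ) / 2 + m) := by push_cast; ring
    have b2 : ((j + 2 * m : ℝ) : ℂ) = 2 * ((j : ℂ) / 2 + m) := by push_cast; ring
    have gen : ∀ A : ℂ, A ≠ 0 → 1 + t * Complex.I / (2 * A) = (A + t * Complex.I / 2) / A := by
      intro A hA
      field_simp
    have b3 : (1 + t * Complex.I / (2 * ((j : ℂ) / 2 + m))) =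
        ((j + t * Complex.I) / 2 + m) / ((j : ℂ) / 2 + m) := by
      rw [gen _ a2]; congr 1; ring
    have b4 : (1 + t * Complex.I / (2 * ((n : ℂ) / 2 + m))) =
        ((n + t * Complex.I) / 2 + m) / ((n : ℂ) / 2 + m) := by
      rw [gen _ a1]; congr 1; ring
    rw [gammaFactor, b1, b2, b3, b4, div_div_div_eq]
  rw [hprod]
  simp only [Complex.GammaSeq, Pi.div_apply]
  have q1 := P j t hj0
  have q2 := P' j hj0
  have q3 := P n t hn0
  have q4 := P' n hn0
  rw [div_mul_div_comm, div_mul_div_comm, div_div_div_eq, div_eq_div_iff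
    (mul_ne_zero (mul_ne_zero q1 q4) (mul_ne_zero (mul_ne_zero (hp0 _) hfac)
      (mul_ne_zero (hp0 _) hfac))) (mul_ne_zero q4 q1)]
  linear_combination ((N.factorial : ℂ) ^ 2 *
    (∏ m ∈ Finset.range (N + 1), ((j : ℂ) / 2 + m : ℂ)) *
    (∏ m ∈ Finset.range (N + 1), ((n + t * Complex.I) / 2 + m : ℂ)) *
    (∏ m ∈ Finset.range (N + 1), ((n : ℂ) / 2 + m : ℂ)) *
    (∏ m ∈ Finset.range (N + 1), ((j + t * Complex.I) / 2 + m : ℂ))) * hpow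

lemma norm_one_add_mul_I_div_sq (x t : ℝ) :
    ‖(1 + t * Complex.I / x : ℂ)‖ ^ 2 = 1 + t ^ 2 / x ^ 2 := by
  have : (1 + t * Complex.I / x : ℂ) = ((1 : ℝ) : ℂ) + ((t / x : ℝ) : ℂ) * Complex.I := by
    push_cast; ring
  rw [this, Complex.sq_norm, Complex.normSq_add_mul_I, div_pow, one_pow]

/-- The squared modulus is (1 + t²/y²)/(1 + t²/x²), which decreases in t² because x ≤ y. -/
lemma norm_gammaFactor_le {x y s t : ℝ} (hx : 0 < x) (hxy : x ≤ y) (hst : |s| ≤ |t|) :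
    ‖gammaFactor x y t‖ ≤ ‖gammaFactor x y s‖ := by
  have hpos : ∀ x t : ℝ, 0 < ‖(1 + t * Complex.I / x : ℂ)‖ := fun x t =>
    norm_pos_iff.2 (one_add_mul_I_div_ne_zero x t)
  unfold gammaFactor
  rw [norm_div, norm_div, div_le_div_iff₀ (hpos _ _) (hpos _ _)]
  refine le_of_sq_le_sq ?_ (by positivity)
  rw [mul_pow, mul_pow]
  simp only [norm_one_add_mul_I_div_sq]
  have h1 : s ^ 2 ≤ t ^ 2 := sq_le_sq.2 hst
  have h2 : (y ^ 2)⁻¹ ≤ (x ^ 2)⁻¹ := by gcongr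
  simp only [div_eq_mul_inv]
  nlinarith [mul_nonneg (sub_nonneg.2 h1) (sub_nonneg.2 h2)]

lemma norm_logDistCharFun_le {n k : ℕ} (hk : k < n) {s t : ℝ} (hst : |s| ≤ |t|) :
    ‖logDistCharFun n k t‖ ≤ ‖logDistCharFun n k s‖ := by
  refine le_of_tendsto_of_tendsto' (tendsto_prod_gammaFactor hk t).norm
    (tendsto_prod_gammaFactor hk s).norm fun N => ?_
  rw [norm_prod, norm_prod]
  refine Finset.prod_le_prod (fun _ _ => norm_nonneg _) fun m _ => norm_gammaFactor_le ?_ ?_ hst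
  · have : 0 < n - k := by omega
    positivity
  · have : ((n - k : ℕ) : ℝ) ≤ n := by exact_mod_cast Nat.sub_le n k
    linarith

/-! ### Cubic expansion of the logarithm. -/

/-- The cubic remainder in the expansion of `log (1 + iu)` at `u = 0`. -/
def logRemainder (u : ℝ) : ℂ := Complex.log (1 + u * Complex.I) - u * Complex.I - u ^ 2 / 2

lemma hasDerivAt_logRemainder (u : ℝ) :
    HasDerivAt logRemainder (-(u ^ 2 * Complex.I) / (1 + u * Complex.I)) u := by
  have hs : (1 + u * Complex.I : ℂ) ∈ Complex.slitPlane := Or.inl (by simp)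
  have h0 := Complex.slitPlane_ne_zero hs
  have hd : HasDerivAt (fun v : ℝ => (1 + v * Complex.I : ℂ)) Complex.I u := by
    simpa using ((Complex.ofRealCLM.hasDerivAt (x := u)).mul_const Complex.I).const_add 1
  have hd2 : HasDerivAt (fun v : ℝ => (v * Complex.I : ℂ)) Complex.I u := by
    simpa using (Complex.ofRealCLM.hasDerivAt (x := u)).mul_const Complex.I
  have hd3 : HasDerivAt (fun v : ℝ => ((v : ℂ) ^ 2 / 2)) (u : ℂ) u := by
    have := ((Complex.ofRealCLM.hasDerivAt (x := u)).pow 2).div_const 2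
    convert! this using 1
    simp
  have := ((hd.clog_real hs).sub hd2).sub hd3
  convert! this using 1
  field_simp
  ring_nf
  simp only [Complex.I_sq]
  ring

/-- The derivative has modulus at most u². Bounding increments rather than values keeps the
cancellation between 1/x³ and 1/y³. -/
lemma norm_logRemainder_sub_le {a b : ℝ} (hab : a ≤ b) :
    ‖logRemainder b - logRemainder a‖ ≤ (b ^ 3 - a ^ 3) / 3 := by
  have h := image_norm_le_of_norm_deriv_right_le_deriv_boundary
    (f := fun u => logRemainder u - logRemainder a)
    (f' := fun u : ℝ => -((u : ℂ) ^ 2 * Complex.I) / (1 + u * Complex.I))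
    (a := a) (b := b) (B := fun u => (u ^ 3 - a ^ 3) / 3) (B' := fun u => u ^ 2)
    (fun u _ => ((hasDerivAt_logRemainder u).sub_const _).continuousAt.continuousWithinAt)
    (fun u _ => ((hasDerivAt_logRemainder u).sub_const _).hasDerivWithinAt) (by simp)
    (fun u => by
      have := (((hasDerivAt_id u).pow 3).sub_const (a ^ 3)).div_const 3
      convert! this using 1
      simp)
    (fun u _ => ?_)
  · exact h (right_mem_Icc.2 hab)
  · have h1 : 1 ≤ ‖(1 + u * Complex.I : ℂ)‖ := by
      have := Complex.abs_re_le_norm (1 + u * Complex.I : ℂ)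
      simpa using this
    rw [norm_div, norm_neg, norm_mul, Complex.norm_I, mul_one, norm_pow, Complex.norm_real,
      Real.norm_eq_abs, sq_abs]
    exact div_le_self (sq_nonneg u) h1

lemma norm_logRemainder_div_sub_le {x y : ℝ} (hx : 0 < x) (hxy : x ≤ y) (t : ℝ) :
    ‖logRemainder (t / y) - logRemainder (t / x)‖
      ≤ |t| ^ 3 / 6 * (2 * (1 / x ^ 3 - 1 / y ^ 3)) := by
  have hy : 0 < y := hx.trans_le hxy
  rcases le_total 0 t with ht | ht
  · have h := norm_logRemainder_sub_le (a := t / y) (b := t / x) (by gcongr)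
    rw [norm_sub_rev]
    refine h.trans (le_of_eq ?_)
    rw [abs_of_nonneg ht]
    field_simp
    ring
  · have hle : t / x ≤ t / y := by
      have : -t / y ≤ -t / x := by
        have : 0 ≤ -t := by linarith
        gcongr
      rw [neg_div, neg_div] at this
      linarith
    refine (norm_logRemainder_sub_le hle).trans (le_of_eq ?_)
    rw [abs_of_nonpos ht]
    field_simp
    ring

lemma gammaFactor_eq_exp {x y : ℝ} (t : ℝ) :
    gammaFactor x y t = Complex.exp (((1 / y - 1 / x : ℝ) : ℂ) * (t * Complex.I)
      + ((1 / x ^ 2 - 1 / y ^ 2 : ℝ) : ℂ) * (-t ^ 2 / 2)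
      + (logRemainder (t / y) - logRemainder (t / x))) := by
  have h : ∀ z : ℝ, (1 + t * Complex.I / z : ℂ) = 1 + ((t / z : ℝ) : ℂ) * Complex.I := by
    intro z; push_cast; ring
  have h0 := one_add_mul_I_div_ne_zero x t
  have h1 := one_add_mul_I_div_ne_zero y t
  rw [h] at h0 h1
  have e : (((1 / y - 1 / x : ℝ) : ℂ) * (t * Complex.I)
      + ((1 / x ^ 2 - 1 / y ^ 2 : ℝ) : ℂ) * (-t ^ 2 / 2)
      + (logRemainder (t / y) - logRemainder (t / x)))
      = Complex.log (1 + ((t / y : ℝ) : ℂ) * Complex.I)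
        - Complex.log (1 + ((t / x : ℝ) : ℂ) * Complex.I) := by
    unfold logRemainder
    push_cast
    ring
  rw [e, Complex.exp_sub, Complex.exp_log h0, Complex.exp_log h1, gammaFactor, h, h]

/-! ### Telescoping bounds for the variance and the cubic coefficient. -/

/-- An upper bound for the third cumulant contribution `∑ 2 (1 / (a + 2m)^3 - 1 / (b + 2m)^3)`. -/
def cubicBound (a b : ℝ) : ℝ :=
  2 * (1 / a ^ 3 - 1 / b ^ 3) + 1 / 2 * (1 / (a * (a + 2)) - 1 / (b * (b + 2)))

/-- The error 1/z² - (1/z - 1/(z+2))/2 = 2/(z²(z+2)) is decreasing in z; the right-hand comparison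
telescopes along steps of 2. -/
lemma half_sub_le_inv_sq_sub {x y : ℝ} (hx : 0 < x) (hxy : x ≤ y) :
    1 / 2 * ((1 / x - 1 / (x + 2)) - (1 / y - 1 / (y + 2))) ≤ 1 / x ^ 2 - 1 / y ^ 2 := by
  have hy : 0 < y := hx.trans_le hxy
  have h : ∀ z : ℝ, 0 < z → 1 / z ^ 2 - 1 / 2 * (1 / z - 1 / (z + 2)) = 2 / (z ^ 2 * (z + 2)) := by
    intro z hz
    field_simp
    ring
  have h2 : 2 / (y ^ 2 * (y + 2)) ≤ 2 / (x ^ 2 * (x + 2)) := by gcongr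
  rw [← h x hx, ← h y hy] at h2
  linarith

/-- Again a telescoping comparison whose error, here 8/(z³(z²-4)), is decreasing. -/
lemma two_mul_inv_cube_sub_le {x y : ℝ} (hx : 2 < x) (hxy : x ≤ y) :
    2 * (1 / x ^ 3 - 1 / y ^ 3) ≤ 1 / 2 * (1 / ((x - 2) * x) - 1 / ((y - 2) * y))
      - 1 / 2 * (1 / (x * (x + 2)) - 1 / (y * (y + 2))) := by
  have h : ∀ z : ℝ, 2 < z → 1 / 2 * (1 / ((z - 2) * z) - 1 / (z * (z + 2))) - 2 * (1 / z ^ 3)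
      = 8 / (z ^ 3 * ((z - 2) * (z + 2))) := by
    intro z hz
    have h1 : z - 2 ≠ 0 := by linarith
    have h2 : z + 2 ≠ 0 := by linarith
    have h3 : z ≠ 0 := by linarith
    field_simp
    ring
  have h2 : 8 / (y ^ 3 * ((y - 2) * (y + 2))) ≤ 8 / (x ^ 3 * ((x - 2) * (x + 2))) := by
    have a1 : 0 < x - 2 := by linarith
    have a2 : 0 < x + 2 := by linarith
    have a3 : 0 < x := by linarith
    have a4 : x - 2 ≤ y - 2 := by linarith
    have a5 : 0 < y := by linarith
    have a6 : 0 < y - 2 := by linarith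
    gcongr
  rw [← h x hx, ← h y (by linarith)] at h2
  linarith

section
variable {a b : ℝ}

lemma sum_inv_sq_sub_ge (ha : 0 < a) (hab : a ≤ b) (N : ℕ) :
    1 / 2 * ((1 / a - 1 / b) - (1 / (a + 2 * N) - 1 / (b + 2 * N)))
      ≤ ∑ m ∈ Finset.range N, (1 / (a + 2 * m) ^ 2 - 1 / (b + 2 * m) ^ 2) := by
  induction N with
  | zero => simp
  | succ N ih =>
    rw [Finset.sum_range_succ]
    have h := half_sub_le_inv_sq_sub (x := a + 2 * N) (y := b + 2 * N) (by positivity) (by linarith)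
    have e : ∀ c : ℝ, c + 2 * ((N + 1 : ℕ) : ℝ) = c + 2 * N + 2 := by intro c; push_cast; ring
    rw [e, e]
    linarith

lemma sum_inv_cube_sub_le (ha : 1 ≤ a) (hab : a ≤ b) (N : ℕ) :
    ∑ m ∈ Finset.range N, 2 * (1 / (a + 2 * m) ^ 3 - 1 / (b + 2 * m) ^ 3) ≤ cubicBound a b := by
  have hanti : ∀ z w : ℝ, 0 < z → z ≤ w → 1 / (w * (w + 2)) ≤ 1 / (z * (z + 2)) := by
    intro z w hz hzw
    have : 0 < w := hz.trans_le hzw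
    gcongr
  -- The term m = 0 is kept exactly, since the comparison needs an argument above 2 and a may be 1.
  have key : ∀ N : ℕ, ∑ m ∈ Finset.range (N + 1), 2 * (1 / (a + 2 * m) ^ 3 - 1 / (b + 2 * m) ^ 3)
      ≤ cubicBound a b - 1 / 2 * (1 / ((a + 2 * N) * (a + 2 * N + 2))
        - 1 / ((b + 2 * N) * (b + 2 * N + 2))) := by
    intro N
    induction N with
    | zero => simp [cubicBound]
    | succ N ih =>
      rw [Finset.sum_range_succ]
      have h := two_mul_inv_cube_sub_le (x := a + 2 * (N + 1 : ℕ)) (y := b + 2 * (N + 1 : ℕ))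
        (by push_cast; nlinarith [(Nat.cast_nonneg N : (0 : ℝ) ≤ N)]) (by linarith)
      have e : ∀ c : ℝ, c + 2 * ((N + 1 : ℕ) : ℝ) - 2 = c + 2 * N := by intro c; push_cast; ring
      have e' : ∀ c : ℝ, c + 2 * ((N + 1 : ℕ) : ℝ) = c + 2 * N + 2 := by intro c; push_cast; ring
      rw [e, e] at h
      rw [e', e'] at h ⊢
      linarith
  rcases N with _ | N
  · have h1 : 1 / b ^ 3 ≤ 1 / a ^ 3 := by
      have : 0 < a := by linarith
      gcongr
    have h2 := hanti a b (by linarith) hab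
    simp only [Finset.range_zero, Finset.sum_empty, cubicBound]
    linarith
  · refine (key N).trans ?_
    have := hanti (a + 2 * N) (b + 2 * N) (by positivity) (by linarith)
    linarith

lemma summable_of_abs_le_inv_sq {f : ℕ → ℝ} {C : ℝ}
    (h : ∀ m, |f m| ≤ C * (1 / ((m : ℝ) + 1) ^ 2)) : Summable f := by
  have h1 : Summable fun m : ℕ => 1 / ((m : ℝ) + 1) ^ 2 := by
    have := (summable_nat_add_iff 1).2 (Real.summable_one_div_nat_pow.2 one_lt_two)
    simpa using this
  exact Summable.of_norm_bounded (h1.mul_left C) h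

lemma inv_pow_sub_le (ha : 1 ≤ a) (hab : a ≤ b) (m i : ℕ) :
    |1 / (a + 2 * m) ^ (i + 2) - 1 / (b + 2 * m) ^ (i + 2)| ≤ 1 * (1 / ((m : ℝ) + 1) ^ 2) := by
  have hm : (0 : ℝ) ≤ m := Nat.cast_nonneg m
  have ha0 : 0 < a := by linarith
  have hb0 : 0 < b := by linarith
  have h1 : 1 / (b + 2 * m) ^ (i + 2) ≤ 1 / (a + 2 * m) ^ (i + 2) := by gcongr
  rw [abs_of_nonneg (by linarith), one_mul]
  have h2 : 0 ≤ 1 / (b + 2 * m) ^ (i + 2) := by positivity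
  have h3 : 1 / (a + 2 * m) ^ (i + 2) ≤ 1 / ((m : ℝ) + 1) ^ 2 := by
    have : (m : ℝ) + 1 ≤ a + 2 * m := by linarith
    calc 1 / (a + 2 * m) ^ (i + 2) ≤ 1 / ((m : ℝ) + 1) ^ (i + 2) := by gcongr
      _ ≤ 1 / ((m : ℝ) + 1) ^ 2 := by
        gcongr
        · linarith
        · linarith
  linarith

lemma inv_sub_le (ha : 1 ≤ a) (hab : a ≤ b) (m : ℕ) :
    |1 / (b + 2 * m) - 1 / (a + 2 * m)| ≤ (b - a) * (1 / ((m : ℝ) + 1) ^ 2) := by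
  have hm : (0 : ℝ) ≤ m := Nat.cast_nonneg m
  have h1 : 0 < a + 2 * m := by linarith
  have h2 : 0 < b + 2 * m := by linarith
  have e : 1 / (b + 2 * m) - 1 / (a + 2 * m) = -((b - a) * (1 / ((a + 2 * m) * (b + 2 * m)))) := by
    field_simp
    ring
  have h3 : 0 ≤ b - a := by linarith
  have h4 : (m : ℝ) + 1 ≤ a + 2 * m := by linarith
  have h5 : (m : ℝ) + 1 ≤ b + 2 * m := by linarith
  rw [e, abs_neg, abs_of_nonneg (by positivity), sq]
  gcongr

/-- The exponents of the factors are summed order by order. The linear coefficients 1/y - 1/x are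
summable only as differences. -/
lemma exists_expansion_of_tendsto (ha : 1 ≤ a) (hab : a ≤ b) {φ : ℝ → ℂ}
    (hφ : ∀ t, Tendsto (fun N => ∏ m ∈ Finset.range N, gammaFactor (a + 2 * m) (b + 2 * m) t) atTop
      (𝓝 (φ t))) :
    ∃ c v : ℝ, 1 / 2 * (1 / a - 1 / b) ≤ v ∧ ∀ t : ℝ, ∃ R : ℂ,
      ‖R‖ ≤ |t| ^ 3 / 6 * cubicBound a b ∧
      φ t = Complex.exp (c * (t * Complex.I) + v * (-t ^ 2 / 2) + R) := by
  have s1 : Summable fun m : ℕ => 1 / (b + 2 * m) - 1 / (a + 2 * m) :=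
    summable_of_abs_le_inv_sq (inv_sub_le ha hab)
  have s2 : Summable fun m : ℕ => 1 / (a + 2 * m) ^ 2 - 1 / (b + 2 * m) ^ 2 :=
    summable_of_abs_le_inv_sq fun m => inv_pow_sub_le ha hab m 0
  have s3 : Summable fun m : ℕ => 2 * (1 / (a + 2 * m) ^ 3 - 1 / (b + 2 * m) ^ 3) :=
    (summable_of_abs_le_inv_sq fun m => inv_pow_sub_le ha hab m 1).mul_left 2
  refine ⟨∑' m : ℕ, (1 / (b + 2 * m) - 1 / (a + 2 * m)),
    ∑' m : ℕ, (1 / (a + 2 * m) ^ 2 - 1 / (b + 2 * m) ^ 2), ?_,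
    fun t => ⟨∑' m : ℕ, (logRemainder (t / (b + 2 * m))
    - logRemainder (t / (a + 2 * m))), ?_, ?_⟩⟩
  · have hlim : ∀ c : ℝ, Tendsto (fun N : ℕ => 1 / (c + 2 * (N : ℝ))) atTop (𝓝 0) := by
      intro c
      refine Tendsto.div_atTop tendsto_const_nhds (tendsto_atTop_add_const_left _ _ ?_)
      exact tendsto_natCast_atTop_atTop.const_mul_atTop two_pos
    have hl : Tendsto (fun N : ℕ => 1 / 2 * ((1 / a - 1 / b)
        - (1 / (a + 2 * (N : ℝ)) - 1 / (b + 2 * (N : ℝ)))))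
      atTop (𝓝 (1 / 2 * (1 / a - 1 / b))) := by
      have := (((hlim a).sub (hlim b)).const_sub (1 / a - 1 / b)).const_mul (1 / 2)
      simpa using this
    exact le_of_tendsto_of_tendsto' hl s2.hasSum.tendsto_sum_nat
      (sum_inv_sq_sub_ge (by linarith) hab)
  · have hb := tsum_of_norm_bounded (s3.mul_left (|t| ^ 3 / 6)).hasSum fun m =>
      norm_logRemainder_div_sub_le (x := a + 2 * m) (y := b + 2 * m) (by positivity)
        (by linarith) t
    refine hb.trans ?_
    rw [tsum_mul_left]
    refine mul_le_mul_of_nonneg_left ?_ (by positivity)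
    exact le_of_tendsto' s3.hasSum.tendsto_sum_nat (sum_inv_cube_sub_le ha hab)
  · have s4 : Summable fun m : ℕ => logRemainder (t / (b + 2 * m))
        - logRemainder (t / (a + 2 * m)) :=
      Summable.of_norm_bounded (s3.mul_left (|t| ^ 3 / 6)) fun m =>
        norm_logRemainder_div_sub_le (x := a + 2 * m) (y := b + 2 * m) (by positivity)
          (by linarith) t
    have h1 := ((Complex.hasSum_ofReal.2 s1.hasSum).mul_right (t * Complex.I)).add
      ((Complex.hasSum_ofReal.2 s2.hasSum).mul_right (-(t : ℂ) ^ 2 / 2))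
    have h2 := (h1.add s4.hasSum).tendsto_sum_nat
    have h3 := (Complex.continuous_exp.tendsto _).comp h2
    refine tendsto_nhds_unique (hφ t) (h3.congr fun N => ?_)
    simp only [Function.comp_apply]
    rw [Complex.exp_sum]
    exact Finset.prod_congr rfl fun m _ => (gammaFactor_eq_exp t).symm

end

/-- The map 3.8u² - 2u³ increases on [0, 1/3], which reduces the claim to n = j + 1. The right-hand
side is chosen because 1/(j(j+1)) telescopes over j. -/
lemma two_mul_inv_cube_sub_inv_cube_le {j n : ℝ} (hj : 2 ≤ j) (hjn : j + 1 ≤ n) :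
    2 * (1 / j ^ 3 - 1 / n ^ 3) ≤ 3.8 * (1 / (j * (j + 1)) - 1 / n ^ 2) := by
  have hj0 : 0 < j := by linarith
  have hn0 : 0 < n := by linarith
  have h1 : 3.8 * (1 / n) ^ 2 - 2 * (1 / n) ^ 3
      ≤ 3.8 * (1 / (j + 1)) ^ 2 - 2 * (1 / (j + 1)) ^ 3 := by
    have hu : 0 ≤ 1 / n := by positivity
    have huv : 1 / n ≤ 1 / (j + 1) := by gcongr
    have hv : 1 / (j + 1) ≤ 1 / 3 := by gcongr; linarith
    generalize 1 / n = u at *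
    generalize 1 / (j + 1) = v at *
    have : 0 ≤ (v - u) * (3.8 * (v + u) - 2 * (v ^ 2 + u * v + u ^ 2)) := by
      refine mul_nonneg (by linarith) ?_
      nlinarith
    nlinarith
  have h2 : 2 / j ^ 3 + (3.8 * (1 / (j + 1)) ^ 2 - 2 * (1 / (j + 1)) ^ 3)
      ≤ 3.8 / (j * (j + 1)) := by
    -- In the variable a = j - 2 the numerator has only nonnegative coefficients.
    obtain ⟨a, ha, rfl⟩ : ∃ a : ℝ, 0 ≤ a ∧ j = 2 + a := ⟨j - 2, by linarith, by ring⟩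
    have : 3.8 / ((2 + a) * (2 + a + 1))
        - (2 / (2 + a) ^ 3 + (3.8 * (1 / (2 + a + 1)) ^ 2 - 2 * (1 / (2 + a + 1)) ^ 3))
        = (3.8 * (2 + a) ^ 2 * (2 + a + 1) - 2 * (3 * (2 + a) ^ 2 + 3 * (2 + a) + 1))
          / ((2 + a) ^ 3 * (2 + a + 1) ^ 3) := by
      field_simp
      ring
    have h3 : 0 ≤ 3.8 * (2 + a) ^ 2 * (2 + a + 1) - 2 * (3 * (2 + a) ^ 2 + 3 * (2 + a) + 1) := by
      ring_nf
      positivity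
    have := this ▸ div_nonneg h3 (by positivity : 0 ≤ (2 + a) ^ 3 * (2 + a + 1) ^ 3)
    linarith
  simp only [div_pow, one_pow] at h1 h2
  simp only [div_eq_mul_inv] at h1 h2 ⊢
  linarith

lemma half_mul_inv_sub_inv_le {j n : ℝ} (hj : 2 ≤ j) (hjn : j + 1 ≤ n) :
    1 / 2 * (1 / (j * (j + 2)) - 1 / (n * (n + 2))) ≤ 1 / (j * (j + 1)) - 1 / n ^ 2 := by
  have hj0 : 0 < j := by linarith
  have hn0 : 0 < n := by linarith
  have e : ∀ z : ℝ, 0 < z → 1 / z ^ 2 - 1 / 2 * (1 / (z * (z + 2)))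
      = 1 / 2 * (1 / z ^ 2 * (1 + 2 / (z + 2))) := by
    intro z hz
    field_simp
    ring
  have h1 : 1 / 2 * (1 / n ^ 2 * (1 + 2 / (n + 2)))
      ≤ 1 / 2 * (1 / (j + 1) ^ 2 * (1 + 2 / (j + 1 + 2))) := by gcongr
  rw [← e n hn0, ← e (j + 1) (by linarith)] at h1
  have h2 : 1 / (j * (j + 1)) - 1 / 2 * (1 / (j * (j + 2)))
      - (1 / (j + 1) ^ 2 - 1 / 2 * (1 / ((j + 1) * (j + 1 + 2))))
      = (5 * j / 2 + 9 / 2)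
        / (j * (j + 1) ^ 2 * (j + 2) * (j + 3)) := by
    rw [show j + 1 + 2 = j + 3 by ring]
    field_simp
    ring
  have h3 : 0 ≤ (5 * j / 2 + 9 / 2)
        / (j * (j + 1) ^ 2 * (j + 2) * (j + 3)) := by
    positivity
  linarith

lemma cubicBound_le {j n : ℝ} (hj : j = 1 ∨ 2 ≤ j) (hjn : j + 1 ≤ n) (hn : 41 ≤ n) :
    cubicBound j n ≤ 4.8 * (1 / (j * (j + 1)) - 1 / n ^ 2) := by
  rcases hj with rfl | hj
  -- The value j = 1, where the bound with constant 3.8 can fail, is checked numerically: 13/6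
  -- against 2.4 - 4.8/41².
  · have h : 1 / n ^ 2 ≤ 1 / 41 ^ 2 := by gcongr
    have hn3 : 0 ≤ 1 / n ^ 3 := by positivity
    have hnn : 0 ≤ 1 / (n * (n + 2)) := by positivity
    have e : cubicBound 1 n = 13 / 6 - 2 * (1 / n ^ 3) - 1 / 2 * (1 / (n * (n + 2))) := by
      rw [cubicBound]; ring
    rw [e]
    norm_num at h ⊢
    norm_num at hnn
    have : 0 ≤ (n ^ 3)⁻¹ := by positivity
    linarith
  · have h1 := two_mul_inv_cube_sub_inv_cube_le hj hjn
    have h2 := half_mul_inv_sub_inv_le hj hjn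
    rw [cubicBound]
    linarith

lemma cubicBound_self (a : ℝ) : cubicBound a a = 0 := by simp [cubicBound]

lemma sum_cubicBound_le {n q : ℕ} (hq : q < n) (hn : 41 ≤ n) :
    ∑ k ∈ Finset.range (q + 1), cubicBound (n - k : ℕ) n
      ≤ 4.8 * (1 / ((n : ℝ) - q) - 1 / n - q / (n : ℝ) ^ 2) := by
  induction q with
  | zero => simp [cubicBound_self]
  | succ q ih =>
    rw [Finset.sum_range_succ]
    have ih := ih (by omega)
    have hn' : (41 : ℝ) ≤ n := by exact_mod_cast hn
    have hq' : (q : ℝ) + 1 + 1 ≤ n := by exact_mod_cast hq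
    have hc : ((n - (q + 1) : ℕ) : ℝ) = n - (q + 1) := by
      rw [Nat.cast_sub (by omega)]; push_cast; ring
    have h := cubicBound_le (j := ((n - (q + 1) : ℕ) : ℝ)) (n := n) (by
      rcases (show n - (q + 1) = 1 ∨ 2 ≤ n - (q + 1) by omega) with h | h
      · left; rw [h]; simp
      · right; exact_mod_cast h) (by rw [hc]; linarith [(Nat.cast_nonneg q : (0 : ℝ) ≤ q)]) hn'
    have e : 1 / ((n : ℝ) - (q + 1)) - 1 / (n - q)
        = 1 / ((n - (q + 1)) * (n - (q + 1) + 1)) := by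
      have h1 : (n : ℝ) - (q + 1) ≠ 0 := by linarith
      have h2 : (n : ℝ) - q ≠ 0 := by linarith
      have h3 : (n : ℝ) - (q + 1) + 1 ≠ 0 := by linarith
      field_simp
      ring
    rw [hc] at h
    rw [hc]
    have e2 : ((q + 1 : ℕ) : ℝ) / (n : ℝ) ^ 2 = q / (n : ℝ) ^ 2 + 1 / (n : ℝ) ^ 2 := by
      push_cast; ring
    rw [e2]
    push_cast
    linarith

/-- Each increment of the logarithm is bounded by log x ≤ x - 1 with x = (n-q)/(n-q-1). -/
lemma log_sub_le_sum {n q : ℕ} (hq : q < n) :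
    Real.log n - Real.log ((n : ℝ) - q) - q / n
      ≤ ∑ k ∈ Finset.range (q + 1), (1 / ((n - k : ℕ) : ℝ) - 1 / n) := by
  induction q with
  | zero => simp
  | succ q ih =>
    rw [Finset.sum_range_succ]
    have ih := ih (by omega)
    have hq' : (q : ℝ) + 1 + 1 ≤ n := by exact_mod_cast hq
    have hc : ((n - (q + 1) : ℕ) : ℝ) = n - (q + 1) := by
      rw [Nat.cast_sub (by omega)]; push_cast; ring
    have h1 : (0 : ℝ) < n - (q + 1) := by linarith
    have h2 : (0 : ℝ) < n - q := by linarith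
    have h := Real.log_le_sub_one_of_pos (div_pos h2 h1)
    rw [Real.log_div h2.ne' h1.ne'] at h
    have e : ((n : ℝ) - q) / (n - (q + 1)) - 1 = 1 / (n - (q + 1)) := by
      field_simp
      ring
    have e2 : ((q + 1 : ℕ) : ℝ) / n = q / n + 1 / n := by push_cast; ring
    rw [hc, e2]
    push_cast
    linarith

/-- The expansion of the characteristic function of the log-volume of the random parallelepiped. -/
lemma exists_expansion_prod_logDistCharFun {n q : ℕ} (hq : q < n) (hn : 41 ≤ n) :
    ∃ c v : ℝ, 1 / 2 * (Real.log n - Real.log ((n : ℝ) - q) - q / n) ≤ v ∧ ∀ t : ℝ, ∃ R : ℂ,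
      ‖R‖ ≤ |t| ^ 3 / 6 * (4.8 * (1 / ((n : ℝ) - q) - 1 / n - q / (n : ℝ) ^ 2)) ∧
      ∏ k ∈ Finset.range (q + 1), logDistCharFun n k t
        = Complex.exp (c * (t * Complex.I) + v * (-t ^ 2 / 2) + R) := by
  have h : ∀ k : ℕ, ∃ c v : ℝ, k < n → 1 / 2 * (1 / ((n - k : ℕ) : ℝ) - 1 / n) ≤ v ∧
      ∀ t : ℝ, ∃ R : ℂ, ‖R‖ ≤ |t| ^ 3 / 6 * cubicBound (n - k : ℕ) n ∧
      logDistCharFun n k t = Complex.exp (c * (t * Complex.I) + v * (-t ^ 2 / 2) + R) := by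
    intro k
    by_cases hk : k < n
    · obtain ⟨c, v, h1, h2⟩ := exists_expansion_of_tendsto (a := (n - k : ℕ)) (b := n)
        (by exact_mod_cast (show 1 ≤ n - k by omega)) (by exact_mod_cast Nat.sub_le n k)
        (tendsto_prod_gammaFactor hk)
      exact ⟨c, v, fun _ => ⟨h1, h2⟩⟩
    · exact ⟨0, 0, fun h => absurd h hk⟩
  choose c v hcv using h
  refine ⟨∑ k ∈ Finset.range (q + 1), c k, ∑ k ∈ Finset.range (q + 1), v k, ?_, fun t => ?_⟩
  · refine (mul_le_mul_of_nonneg_left (log_sub_le_sum hq) (by norm_num)).trans ?_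
    rw [Finset.mul_sum]
    exact Finset.sum_le_sum fun k hk => (hcv k (by have := Finset.mem_range.1 hk; omega)).1
  · have hR : ∀ k : ℕ, ∃ R : ℂ, k < n → ‖R‖ ≤ |t| ^ 3 / 6 * cubicBound (n - k : ℕ) n ∧
        logDistCharFun n k t
          = Complex.exp (c k * (t * Complex.I) + v k * (-t ^ 2 / 2) + R) := by
      intro k
      by_cases hk : k < n
      · obtain ⟨R, hR⟩ := (hcv k hk).2 t
        exact ⟨R, fun _ => hR⟩
      · exact ⟨0, fun h => absurd h hk⟩
    choose R hR using hR
    refine ⟨∑ k ∈ Finset.range (q + 1), R k, ?_, ?_⟩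
    · refine le_trans ?_ (mul_le_mul_of_nonneg_left (sum_cubicBound_le hq hn) (by positivity))
      rw [Finset.mul_sum]
      exact norm_sum_le_of_le _ fun k hk => (hR k (by have := Finset.mem_range.1 hk; omega)).1
    · push_cast
      rw [Finset.sum_mul, Finset.sum_mul, ← Finset.sum_add_distrib, ← Finset.sum_add_distrib,
        Complex.exp_sum]
      exact Finset.prod_congr rfl fun k hk => (hR k (by have := Finset.mem_range.1 hk; omega)).2

/-! ### Moments from the characteristic function. -/

lemma charFun_sub_quadratic_isLittleO {f : ℝ → ℂ} {v K : ℝ}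
    (hf : ∀ t : ℝ, ∃ R : ℂ, ‖R‖ ≤ K * |t| ^ 3 ∧ f t = Complex.exp (v * (-t ^ 2 / 2) + R)) :
    (fun t : ℝ => f t - (1 - v * t ^ 2 / 2)) =o[𝓝 0] fun t : ℝ => t ^ 2 := by
  choose R hR hf using hf
  have hcube : (fun t : ℝ => |t| ^ 3) =o[𝓝 0] fun t : ℝ => t ^ 2 := by
    have h : (fun t : ℝ => t ^ 3) =o[𝓝 0] fun t : ℝ => t ^ 2 := isLittleO_pow_pow (by norm_num)
    refine h.norm_left.congr_left fun t => ?_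
    simp
  have hRo : R =o[𝓝 0] fun t : ℝ => t ^ 2 := by
    refine IsBigO.trans_isLittleO (IsBigO.of_bound K (Eventually.of_forall fun t => ?_)) hcube
    simpa using hR t
  set g : ℝ → ℂ := fun t => v * (-t ^ 2 / 2) + R t with hg
  have hq : (fun t : ℝ => (v * (-t ^ 2 / 2) : ℂ)) =O[𝓝 0] fun t : ℝ => t ^ 2 := by
    refine IsBigO.of_bound (|v| / 2) (Eventually.of_forall fun t => le_of_eq ?_)
    simp
    ring
  have hgO : g =O[𝓝 0] fun t : ℝ => t ^ 2 := hq.add hRo.isBigO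
  have hg0 : Tendsto g (𝓝 0) (𝓝 0) := hgO.trans_tendsto <| by
    simpa using (continuous_pow 2).tendsto (0 : ℝ)
  have hexp : (fun z : ℂ => Complex.exp z - 1 - z) =o[𝓝 0] fun z : ℂ => z := by
    have := (Complex.hasDerivAt_exp 0).isLittleO
    simpa using this
  have h1 := (hexp.comp_tendsto hg0).trans_isBigO hgO
  refine (h1.add hRo).congr_left fun t => ?_
  simp only [Function.comp, hf, hg]
  ring

/-- Fatou's lemma along u → 0: E[(1 - cos uX)/u²] stays bounded, while the integrand is at least
2x²/π² once |ux| ≤ π. -/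
lemma memLp_two_of_charFun_isBigO {ν : Measure ℝ} [IsProbabilityMeasure ν]
    (h : (fun t : ℝ => charFun ν t - 1) =O[𝓝 0] fun t : ℝ => t ^ 2) : MemLp id 2 ν := by
  obtain ⟨C, hC⟩ := h.bound
  have hu : Tendsto (fun k : ℕ => 1 / ((k : ℝ) + 1)) atTop (𝓝 0) :=
    tendsto_one_div_add_atTop_nhds_zero_nat
  set u : ℕ → ℝ := fun k => 1 / ((k : ℝ) + 1)
  have hu0 : ∀ k, 0 < u k := fun k => by positivity
  set F : ℕ → ℝ → ℝ≥0∞ := fun k x => ENNReal.ofReal ((1 - Real.cos (u k * x)) / u k ^ 2) with hF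
  have hint : ∀ k, ∫⁻ x, F k x ∂ν = ENNReal.ofReal ((1 - charFun ν (u k)).re / u k ^ 2) := by
    intro k
    have hi : Integrable (fun x : ℝ => Complex.exp (u k * x * Complex.I)) ν := by
      refine Integrable.of_bound (by fun_prop) 1 (Eventually.of_forall fun x => ?_)
      rw [← Complex.ofReal_mul, Complex.norm_exp_ofReal_mul_I]
    have hre : (charFun ν (u k)).re = ∫ x, Real.cos (u k * x) ∂ν := by
      rw [charFun_apply_real, ← RCLike.re_eq_complex_re, ← integral_re hi]
      congr with x
      rw [← Complex.ofReal_mul, RCLike.re_eq_complex_re, Complex.exp_ofReal_mul_I_re]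
    have hic : Integrable (fun x : ℝ => Real.cos (u k * x)) ν :=
      Integrable.of_bound (by fun_prop) 1
        (Eventually.of_forall fun x => by simpa using Real.abs_cos_le_one _)
    rw [← ofReal_integral_eq_lintegral_ofReal]
    · rw [integral_div, integral_sub (integrable_const _) hic, Complex.sub_re, hre]
      simp
    · exact ((integrable_const _).sub hic).div_const _
    · exact Eventually.of_forall fun x =>
        div_nonneg (sub_nonneg.2 (Real.cos_le_one _)) (sq_nonneg _)
  have hbound : ∀ᶠ k in atTop, ∫⁻ x, F k x ∂ν ≤ ENNReal.ofReal C := by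
    filter_upwards [hu.eventually hC] with k hk
    rw [hint]
    refine ENNReal.ofReal_le_ofReal ?_
    rw [div_le_iff₀ (by have := hu0 k; positivity)]
    calc _ ≤ ‖1 - charFun ν (u k)‖ := Complex.re_le_norm _
      _ ≤ C * ‖u k ^ 2‖ := by rw [norm_sub_rev]; exact hk
      _ = _ := by simp
  have hpt : ∀ x : ℝ, ENNReal.ofReal (2 / Real.pi ^ 2 * x ^ 2) ≤ liminf (fun k => F k x) atTop := by
    intro x
    refine le_liminf_of_le (by isBoundedDefault) ?_
    have hux : Tendsto (fun k => |u k * x|) atTop (𝓝 0) := by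
      simpa using (hu.mul_const x).abs
    filter_upwards [hux.eventually_lt_const Real.pi_pos] with k hk
    refine ENNReal.ofReal_le_ofReal ?_
    have := Real.cos_le_one_sub_mul_cos_sq hk.le
    rw [le_div_iff₀ (by have := hu0 k; positivity)]
    linarith [mul_pow (u k) x 2]
  have hfin : ∫⁻ x : ℝ, ENNReal.ofReal (2 / Real.pi ^ 2 * x ^ 2) ∂ν < ∞ := by
    calc _ ≤ ∫⁻ x, liminf (fun k => F k x) atTop ∂ν := lintegral_mono hpt
      _ ≤ liminf (fun k => ∫⁻ x, F k x ∂ν) atTop := lintegral_liminf_le fun k => by fun_prop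
      _ ≤ ENNReal.ofReal C := liminf_le_of_frequently_le' hbound.frequently
      _ < ∞ := ENNReal.ofReal_lt_top
  have hi : Integrable (fun x : ℝ => 2 / Real.pi ^ 2 * x ^ 2) ν := by
    refine ⟨by fun_prop, ?_⟩
    rw [hasFiniteIntegral_iff_ofReal (Eventually.of_forall fun x => by positivity)]
    exact hfin
  rw [memLp_two_iff_integrable_sq (by fun_prop)]
  refine (hi.const_mul (Real.pi ^ 2 / 2)).congr (Eventually.of_forall fun x => ?_)
  have := Real.pi_pos
  simp only [id]
  field_simp

/-- With the second moment finite, the Taylor expansion at 0 is available, and comparing it with the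
given one identifies the coefficients. -/
lemma moments_of_charFun {ν : Measure ℝ} [IsProbabilityMeasure ν] {v K : ℝ}
    (hf : ∀ t : ℝ, ∃ R : ℂ, ‖R‖ ≤ K * |t| ^ 3 ∧
      charFun ν t = Complex.exp (v * (-t ^ 2 / 2) + R)) :
    MemLp id 2 ν ∧ ∫ x, x ∂ν = 0 ∧ ∫ x, x ^ 2 ∂ν = v := by
  have ho := charFun_sub_quadratic_isLittleO hf
  have hq : (fun t : ℝ => (v * t ^ 2 / 2 : ℂ)) =O[𝓝 0] fun t : ℝ => t ^ 2 := by
    refine IsBigO.of_bound (|v| / 2) (Eventually.of_forall fun t => le_of_eq ?_)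
    simp
    ring
  have hL : MemLp id 2 ν := memLp_two_of_charFun_isBigO
    ((ho.isBigO.sub hq).congr_left fun t => by ring)
  have hT : (fun t : ℝ => charFun ν t
      - (1 + (∫ x, x ∂ν : ℝ) * t * Complex.I - (∫ x, x ^ 2 ∂ν : ℝ) * t ^ 2 / 2)) =o[𝓝 0]
      fun t : ℝ => t ^ 2 := by
    have h := taylor_isLittleO_univ (x₀ := (0 : ℝ)) (contDiff_charFun (n := 2) hL)
    simp only [sub_zero] at h
    refine h.congr_left fun t => ?_
    have := taylorWithinEval_charFun_two_zero (P := ν) (X := id) aemeasurable_id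
      (by simpa using hL) t
    simp only [Measure.map_id] at this
    rw [this]
    rfl
  have hD := ho.sub hT
  set m := ∫ x, x ∂ν
  set M := ∫ x, x ^ 2 ∂ν
  have hD' : (fun t : ℝ => ((m * t : ℝ) * Complex.I + ((v - M) / 2 * t ^ 2 : ℝ))) =o[𝓝 0]
      fun t : ℝ => t ^ 2 := hD.congr_left fun t => by push_cast; ring
  have him : (fun t : ℝ => m * t) =o[𝓝 0] fun t : ℝ => t ^ 2 :=
    IsBigO.trans_isLittleO (IsBigO.of_bound 1 (Eventually.of_forall fun t => by
      have := Complex.abs_im_le_norm ((m * t : ℝ) * Complex.I + ((v - M) / 2 * t ^ 2 : ℝ))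
      rw [one_mul]
      refine le_trans (le_of_eq ?_) this
      rw [Complex.add_im, Complex.im_ofReal_mul, Complex.I_im, mul_one,
        Complex.ofReal_im, add_zero, Real.norm_eq_abs])) hD'
  have hre : (fun t : ℝ => (v - M) / 2 * t ^ 2) =o[𝓝 0] fun t : ℝ => t ^ 2 :=
    IsBigO.trans_isLittleO (IsBigO.of_bound 1 (Eventually.of_forall fun t => by
      have := Complex.abs_re_le_norm ((m * t : ℝ) * Complex.I + ((v - M) / 2 * t ^ 2 : ℝ))
      rw [one_mul]
      refine le_trans (le_of_eq ?_) this
      rw [Complex.add_re, Complex.re_ofReal_mul, Complex.I_re, mul_zero, zero_add,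
        Complex.ofReal_re, Real.norm_eq_abs])) hD'
  have key : ∀ (a : ℝ) (k : ℕ), (fun t : ℝ => a * t ^ k) =o[𝓝 0] (fun t : ℝ => t ^ k) → a = 0 := by
    intro a k h
    by_contra ha
    rw [isLittleO_const_mul_left_iff ha] at h
    refine isLittleO_irrefl' ?_ h
    have : ∃ᶠ t in 𝓝[>] (0 : ℝ), ‖t ^ k‖ ≠ 0 := by
      refine Eventually.frequently ?_
      filter_upwards [self_mem_nhdsWithin] with t ht
      exact norm_ne_zero_iff.2 (pow_ne_zero k (ne_of_gt ht))
    exact this.filter_mono nhdsWithin_le_nhds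
  refine ⟨hL, key m 1 ?_, ?_⟩
  · simpa using him.trans_isBigO (isLittleO_pow_id (by norm_num : 1 < 2)).isBigO
  · have := key _ 2 hre
    linarith

lemma memLp_integral_variance_of_charFun {ν : Measure ℝ} [IsProbabilityMeasure ν] {c v K : ℝ}
    (hf : ∀ t : ℝ, ∃ R : ℂ, ‖R‖ ≤ K * |t| ^ 3 ∧
      charFun ν t = Complex.exp (c * (t * Complex.I) + v * (-t ^ 2 / 2) + R)) :
    MemLp id 2 ν ∧ ∫ x, x ∂ν = c ∧ Var[id; ν] = v := by
  have hm : Measurable fun x : ℝ => x - c := by fun_prop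
  have : IsProbabilityMeasure (ν.map fun x => x - c) :=
    Measure.isProbabilityMeasure_map hm.aemeasurable
  obtain ⟨hL, h1, h2⟩ := moments_of_charFun (ν := ν.map fun x => x - c) (v := v) (K := K) <| by
    intro t
    obtain ⟨R, hR, he⟩ := hf t
    refine ⟨R, hR, ?_⟩
    simp_rw [sub_eq_add_neg]
    rw [charFun_map_add_const, he, ← Complex.exp_add]
    congr 1
    simp
    ring
  rw [memLp_map_measure_iff (by fun_prop) hm.aemeasurable] at hL
  rw [integral_map hm.aemeasurable (by fun_prop)] at h1 h2
  have hL' : MemLp id 2 ν := by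
    simpa [Function.comp_def, Pi.add_def, id_def] using! hL.add (memLp_const c)
  have hi : Integrable (fun x : ℝ => x) ν := hL'.integrable (by norm_num)
  have hc : ∫ x, x ∂ν = c := by
    rw [integral_sub hi (integrable_const c)] at h1
    simp at h1
    linarith
  refine ⟨hL', hc, ?_⟩
  rw [variance_eq_integral aemeasurable_id]
  simpa [hc] using h2

/-! ### Standardization and constants. -/

lemma gaussianReal_Iio_eq_integral (r : ℝ) :
    (gaussianReal 0 1).real (Iio r) = ∫ u in Iio r, Real.exp (-u ^ 2 / 2) / √(2 * Real.pi) := by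
  rw [measureReal_def, gaussianReal_apply_eq_integral _ one_ne_zero, ENNReal.toReal_ofReal]
  · congr with u
    simp [gaussianPDFReal]
    ring
  · exact integral_nonneg fun u => gaussianPDFReal_nonneg _ _ _

lemma abs_measureReal_standardized_sub_gaussian_le {μ : Measure ℝ} [IsProbabilityMeasure μ]
    {c v K δ : ℝ} (hv : 0 < v) (hK : K / √v ^ 3 ≤ δ) (hδ : 0 < δ) (hδ2 : δ ≤ 1 / 2)
    (hf : ∀ t : ℝ, ∃ R : ℂ, ‖R‖ ≤ |t| ^ 3 / 6 * K ∧
      charFun μ t = Complex.exp (c * (t * Complex.I) + v * (-t ^ 2 / 2) + R))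
    (hanti : ∀ s t : ℝ, |s| ≤ |t| → ‖charFun μ t‖ ≤ ‖charFun μ s‖) (r : ℝ) :
    |μ.real {x | (x - c) / √v < r} - (gaussianReal 0 1).real (Iio r)| ≤ 2 * δ := by
  have hsv : 0 < √v := Real.sqrt_pos.2 hv
  have hL := (memLp_integral_variance_of_charFun (K := K / 6) (v := v) (c := c) fun t => by
    obtain ⟨R, hR, h⟩ := hf t
    exact ⟨R, hR.trans_eq (by ring), h⟩).1
  have hm : Measurable fun x : ℝ => (x - c) / √v := by fun_prop
  set ν := μ.map fun x => (x - c) / √v with hν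
  have : IsProbabilityMeasure ν := Measure.isProbabilityMeasure_map hm.aemeasurable
  have hchar : ∀ t : ℝ, charFun ν t
      = Complex.exp (-(c * ((t / √v : ℝ) * Complex.I))) * charFun μ (t / √v) := by
    intro t
    have h : ν = (μ.map fun x => x + -c).map fun x => (√v)⁻¹ * x := by
      rw [Measure.map_map (by fun_prop) (by fun_prop), hν]
      congr with x
      simp only [Function.comp]
      field_simp
      ring
    rw [h, charFun_map_mul, charFun_map_add_const, mul_comm, div_eq_inv_mul]
    congr 2
    simp
    ring
  have hnorm : ∀ t : ℝ, ‖charFun ν t‖ = ‖charFun μ (t / √v)‖ := by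
    intro t
    rw [hchar, norm_mul, show -((c : ℂ) * ((t / √v : ℝ) * Complex.I))
      = ((-(c * (t / √v)) : ℝ) : ℂ) * Complex.I by push_cast; ring,
      Complex.norm_exp_ofReal_mul_I, one_mul]
  have hint : Integrable id ν := by
    rw [hν, integrable_map_measure (by fun_prop) hm.aemeasurable]
    exact ((hL.integrable (by norm_num)).sub (integrable_const c)).div_const _
  have key := abs_measureReal_Iio_sub_gaussian_le hint hδ hδ2 (fun t => ?_) (fun s t hst => ?_) r
  · rwa [hν, map_measureReal_apply hm measurableSet_Iio] at key
  · obtain ⟨R, hR, h⟩ := hf (t / √v)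
    refine ⟨R, ?_, ?_⟩
    · calc ‖R‖ ≤ |t / √v| ^ 3 / 6 * K := hR
        _ = |t| ^ 3 / 6 * (K / √v ^ 3) := by
          rw [abs_div, abs_of_pos hsv]
          field_simp
        _ ≤ |t| ^ 3 / 6 * δ := by gcongr
        _ = δ * |t| ^ 3 / 6 := by ring
    · rw [hchar, h, ← Complex.exp_add]
      congr 1
      have h2 : (v : ℂ) = (√v : ℂ) ^ 2 := by
        rw [← Complex.ofReal_pow, Real.sq_sqrt hv.le]
      have h3 : (√v : ℂ) ≠ 0 := by exact_mod_cast hsv.ne'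
      rw [h2]
      push_cast
      field_simp
      ring
  · rw [hnorm, hnorm]
    refine hanti _ _ ?_
    rw [abs_div, abs_div]
    gcongr

/-- The first two terms of the series of -log(1-θ). This yields both the positivity of the variance
and the bound of order 1/(p-1). -/
lemma half_sq_le_log_inv_sub {θ : ℝ} (h0 : 0 ≤ θ) (h1 : θ < 1) :
    θ ^ 2 / 2 ≤ Real.log (1 / (1 - θ)) - θ := by
  have h := Real.hasSum_pow_div_log_of_abs_lt_one (x := θ) (by rw [abs_of_nonneg h0]; exact h1)
  have h2 := h.summable.sum_le_tsum (Finset.range 2) fun i _ => by positivity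
  rw [h.tsum_eq] at h2
  rw [one_div, Real.log_inv]
  norm_num [Finset.sum_range_succ] at h2
  linarith

lemma berryBound_le {n q : ℕ} (hq : 0 < q) (hqn : q < n) {φ : ℝ} (hφ : φ < 1)
    (h : (q : ℝ) / n ≤ φ) :
    berryBound n (q / n) ≤ 2 * √2 * 28 / (1 - φ) / q := by
  have hq' : (0 : ℝ) < q := by exact_mod_cast hq
  have hn' : (0 : ℝ) < n := by exact_mod_cast hq.trans hqn
  set θ := (q : ℝ) / n with hθ
  have hθ0 : 0 < θ := by positivity
  have hqθ : (q : ℝ) = n * θ := by rw [hθ]; field_simp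
  have hL := half_sq_le_log_inv_sub hθ0.le (h.trans_lt hφ)
  have hpow : (θ ^ 2 / 2) ^ (3 / 2 : ℝ) = θ ^ 3 / (2 * √2) := by
    rw [show (3 / 2 : ℝ) = 1 / 2 * (3 : ℕ) by norm_num, Real.rpow_mul (by positivity),
      ← Real.sqrt_eq_rpow, Real.rpow_natCast, Real.sqrt_div (by positivity),
      Real.sqrt_sq hθ0.le, div_pow]
    congr 1
    rw [pow_succ, Real.sq_sqrt (by norm_num)]
  have hφ' : 0 < 1 - φ := by linarith
  calc berryBound n θ
      ≤ 28 * θ ^ 2 / (n * (1 - φ) * (θ ^ 2 / 2) ^ (3 / 2 : ℝ)) := by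
        rw [berryBound]
        have : 0 ≤ 1 - θ := by linarith
        gcongr
    _ = _ := by
        rw [hpow, hqθ]
        field_simp

lemma map_log_sphereVolume {n p : ℕ} [NeZero n] {Ω : Type*} [MeasurableSpace Ω] {P : Measure Ω}
    [IsProbabilityMeasure P] {Θ : Fin p → Ω → Metric.sphere (0 : EuclideanSpace ℝ (Fin n)) 1}
    (hlaw : ∀ i, HasLaw (Θ i) (uniformSphere n) P) (hindep : iIndepFun Θ P) :
    P.map (fun ω i => Θ i ω) = sphereProduct n p := by
  rw [(iIndepFun_iff_map_fun_eq_pi_map fun i => (hlaw i).aemeasurable).1 hindep, sphereProduct]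
  congr with i : 1
  exact (hlaw i).map_eq

lemma simplexVolume_eq_sphereVolume_mul {n p : ℕ}
    {y : Fin p → Metric.sphere (0 : EuclideanSpace ℝ (Fin n)) 1} (hy : sphereVolume y ≠ 0) :
    simplexVolume (fun i => (y i : EuclideanSpace ℝ (Fin n)))
      = sphereVolume y * volume.real (cornerSimplex p) :=
  simplexVolume_eq (linearIndependent_of_gramSchmidtVolume_ne_zero hy)

lemma volume_real_cornerSimplex_pos (p : ℕ) : 0 < volume.real (cornerSimplex p) :=
  ENNReal.toReal_pos (volume_cornerSimplex_ne_zero p) (volume_cornerSimplex_ne_top p)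

lemma norm_charFun_log_sphereVolume_le {n p : ℕ} [NeZero n] (hpn : p ≤ n) {s t : ℝ}
    (hst : |s| ≤ |t|) :
    ‖charFun ((sphereProduct n p).map fun y => Real.log (sphereVolume y)) t‖
      ≤ ‖charFun ((sphereProduct n p).map fun y => Real.log (sphereVolume y)) s‖ := by
  rw [charFun_log_sphereVolume hpn, charFun_log_sphereVolume hpn, norm_prod, norm_prod]
  refine Finset.prod_le_prod (fun _ _ => norm_nonneg _) fun k hk => ?_
  exact norm_logDistCharFun_le ((Finset.mem_range.1 hk).trans_le hpn) hst

lemma cubic_coeff_div_sqrt_pow_le {n q : ℕ} (hq : 0 < q) (hqn : q < n) {v : ℝ}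
    (hv : 1 / 2 * (Real.log (1 / (1 - (q : ℝ) / n)) - q / n) ≤ v) :
    4.8 * (1 / ((n : ℝ) - q) - 1 / n - q / (n : ℝ) ^ 2) / √v ^ 3
      ≤ 1 / 2 * berryBound n (q / n) := by
  have hq' : (0 : ℝ) < q := by exact_mod_cast hq
  have hn' : (0 : ℝ) < n := by exact_mod_cast hq.trans hqn
  have hqn' : (0 : ℝ) < n - q := by
    have : (q : ℝ) < n := by exact_mod_cast hqn
    linarith
  set θ := (q : ℝ) / n with hθ
  have hθ0 : 0 < θ := by positivity
  have hθ1 : 1 - θ = (n - q) / n := by rw [hθ]; field_simp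
  have hθ1' : 0 < 1 - θ := by rw [hθ1]; positivity
  have hL := half_sq_le_log_inv_sub hθ0.le (by linarith)
  set L := Real.log (1 / (1 - θ)) - θ
  have hL0 : 0 < L := lt_of_lt_of_le (by positivity) hL
  have hA : 1 / ((n : ℝ) - q) - 1 / n - q / (n : ℝ) ^ 2 = θ ^ 2 / (n * (1 - θ)) := by
    rw [hθ1, hθ]
    field_simp
    ring
  have hpow : L ^ (3 / 2 : ℝ) = √L ^ 3 := by
    rw [show (3 / 2 : ℝ) = 1 / 2 * (3 : ℕ) by norm_num, Real.rpow_mul hL0.le,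
      ← Real.sqrt_eq_rpow, Real.rpow_natCast]
  have hsL : 0 < √L := Real.sqrt_pos.2 hL0
  -- Source of the constant 28: the factor 1/2 in the variance bound costs 2^(3/2), and 4.8 ·
  -- 2^(3/2) ≤ 14 = 28/2.
  have h2 : √2 ^ 3 ≤ 28 / 9.6 := by
    rw [pow_succ, Real.sq_sqrt (by norm_num)]
    have : √2 ≤ 35 / 24 := by
      rw [Real.sqrt_le_left (by norm_num)]
      norm_num
    linarith
  have hsv : √L / √2 ≤ √v := by
    rw [← Real.sqrt_div hL0.le]
    exact Real.sqrt_le_sqrt (by linarith)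
  calc 4.8 * (1 / ((n : ℝ) - q) - 1 / n - q / (n : ℝ) ^ 2) / √v ^ 3
      ≤ 4.8 * (θ ^ 2 / (n * (1 - θ))) / (√L / √2) ^ 3 := by
        rw [hA]
        gcongr
    _ = 4.8 * θ ^ 2 / (n * (1 - θ) * √L ^ 3) * √2 ^ 3 := by
        rw [div_pow]
        field_simp
    _ ≤ 4.8 * θ ^ 2 / (n * (1 - θ) * √L ^ 3) * (28 / 9.6) := by gcongr
    _ = 1 / 2 * berryBound n θ := by
        rw [berryBound, hpow]
        ring

end SphericalSimplex

end

/-! ### The main theorem. -/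

open Filter SphericalSimplex

theorem theoremA (n p : ℕ) (hp : 41 ≤ p) (hpn : p ≤ n)
    {Ω : Type*} [MeasurableSpace Ω] (P : Measure Ω) [IsProbabilityMeasure P]
    (Θ : Fin p → Ω → Metric.sphere (0 : EuclideanSpace ℝ (Fin n)) 1)
    (hlaw : ∀ i, HasLaw (Θ i) (SphericalSimplex.uniformSphere n) P)
    (hindep : iIndepFun Θ P)
    (θ : ℝ) (hθ : θ = ((p : ℝ) - 1) / (n : ℝ)) :
    -- the simplex is almost surely non-degenerate, and its log-volume has a finite second moment
    -- and a positive variance, so that it can be standardized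
    (∀ᵐ ω ∂P, 0 < SphericalSimplex.simplexVolume
      fun i => (Θ i ω : EuclideanSpace ℝ (Fin n))) ∧
    MemLp (SphericalSimplex.logVolume Θ) 2 P ∧
    0 < Var[SphericalSimplex.logVolume Θ; P] ∧
    -- the Berry–Esseen bound
    SphericalSimplex.ksDistGaussian P
        (SphericalSimplex.standardize P (SphericalSimplex.logVolume Θ)) ≤
      SphericalSimplex.berryBound n θ ∧
    -- the bound is of order `1 / p` when `θ` is bounded away from one
    ∀ φ ∈ Ioo (0 : ℝ) 1, θ ≤ φ →
      SphericalSimplex.berryBound n θ ≤ 2 * √2 * 28 / (1 - φ) / ((p : ℝ) - 1) := by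
  obtain ⟨q, rfl⟩ : ∃ q, p = q + 1 := ⟨p - 1, by omega⟩
  have hqn : q < n := hpn
  have hq : 0 < q := by omega
  have : NeZero n := ⟨by omega⟩
  rw [show ((q + 1 : ℕ) : ℝ) - 1 = q by push_cast; ring] at hθ ⊢
  subst hθ
  have hq' : (0 : ℝ) < q := by exact_mod_cast hq
  have hqn' : (q : ℝ) < n := by exact_mod_cast hqn
  have hn' : (0 : ℝ) < n := hq'.trans hqn'
  have hθ1 : (q : ℝ) / n < 1 := (div_lt_one hn').2 hqn'
  have hjoint : AEMeasurable (fun ω i => Θ i ω) P :=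
    aemeasurable_pi_lambda _ fun i => (hlaw i).aemeasurable
  have hmap := map_log_sphereVolume hlaw hindep
  have hne : ∀ᵐ ω ∂P, sphereVolume (fun i => Θ i ω) ≠ 0 :=
    ae_of_ae_map hjoint (hmap ▸ ae_sphereVolume_ne_zero hpn)
  have hlog : Measurable fun y : Fin (q + 1) → Metric.sphere (0 : EuclideanSpace ℝ (Fin n)) 1 =>
      Real.log (sphereVolume y) := Real.measurable_log.comp (measurable_sphereVolume n (q + 1))
  set Y : Ω → ℝ := fun ω => Real.log (sphereVolume fun i => Θ i ω) with hY
  have hYm : AEMeasurable Y P := hlog.comp_aemeasurable hjoint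
  have hYlaw : P.map Y = (sphereProduct n (q + 1)).map fun y => Real.log (sphereVolume y) := by
    rw [← hmap, AEMeasurable.map_map_of_aemeasurable hlog.aemeasurable hjoint]
    rfl
  have : IsProbabilityMeasure (P.map Y) := Measure.isProbabilityMeasure_map hYm
  have hpos := volume_real_cornerSimplex_pos (q + 1)
  set C := Real.log (volume.real (cornerSimplex (q + 1)))
  have hW : logVolume Θ =ᵐ[P] fun ω => Y ω + C := by
    filter_upwards [hne] with ω hω
    rw [logVolume, simplexVolume_eq_sphereVolume_mul hω, Real.log_mul hω hpos.ne']
  obtain ⟨c, v, hv, hexp⟩ := exists_expansion_prod_logDistCharFun hqn (by omega : 41 ≤ n)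
  have hf : ∀ t : ℝ, ∃ R : ℂ,
      ‖R‖ ≤ |t| ^ 3 / 6 * (4.8 * (1 / ((n : ℝ) - q) - 1 / n - q / (n : ℝ) ^ 2)) ∧
      charFun (P.map Y) t = Complex.exp (c * (t * Complex.I) + v * (-t ^ 2 / 2) + R) := by
    intro t
    rw [hYlaw, charFun_log_sphereVolume hpn]
    exact hexp t
  obtain ⟨hmem, hmean, hvar⟩ := memLp_integral_variance_of_charFun
    (K := 4.8 * (1 / ((n : ℝ) - q) - 1 / n - q / (n : ℝ) ^ 2) / 6) fun t => by
      obtain ⟨R, hR, h⟩ := hf t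
      exact ⟨R, hR.trans_eq (by ring), h⟩
  rw [memLp_map_measure_iff (by fun_prop) hYm, Function.id_comp] at hmem
  rw [integral_map hYm (by fun_prop)] at hmean
  rw [variance_map (by fun_prop) hYm, Function.id_comp] at hvar
  have hlogθ : Real.log (1 / (1 - (q : ℝ) / n)) = Real.log n - Real.log ((n : ℝ) - q) := by
    rw [← Real.log_div hn'.ne' (by linarith)]
    congr 1
    have : (n : ℝ) - q ≠ 0 := by linarith
    field_simp
  rw [← hlogθ] at hv
  have hL := half_sq_le_log_inv_sub (by positivity) hθ1
  have hL0 : 0 < Real.log (1 / (1 - (q : ℝ) / n)) - q / n := lt_of_lt_of_le (by positivity) hL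
  have hv0 : 0 < v := by linarith
  have hYint : Integrable Y P := hmem.integrable (by norm_num)
  have hWvar : Var[logVolume Θ; P] = v := by
    rw [variance_congr hW, ← hvar]
    exact variance_add_const hmem.aestronglyMeasurable C
  have hWmean : ∫ ω, logVolume Θ ω ∂P = c + C := by
    rw [integral_congr_ae hW, integral_add hYint (integrable_const C), hmean]
    simp
  refine ⟨?_, ?_, ?_, ?_, ?_⟩
  · filter_upwards [hne] with ω hω
    rw [simplexVolume_eq_sphereVolume_mul hω]
    exact mul_pos (lt_of_le_of_ne (sphereVolume_nonneg _) hω.symm) hpos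
  · exact (memLp_congr_ae hW).2 (hmem.add (memLp_const C))
  · rwa [hWvar]
  · have hset : ∀ r : ℝ, P.real {ω | standardize P (logVolume Θ) ω < r}
        = (P.map Y).real {x | (x - c) / √v < r} := by
      intro r
      rw [map_measureReal_apply_of_aemeasurable hYm (measurableSet_lt (by fun_prop) (by fun_prop))]
      refine measureReal_congr (eventuallyEq_set.2 ?_)
      filter_upwards [hW] with ω hω
      have : standardize P (logVolume Θ) ω = (Y ω - c) / √v := by
        rw [standardize, hWvar, hWmean, hω]
        ring
      rw [mem_preimage, mem_ofPred_eq, this]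
    refine ciSup_le fun r => ?_
    rw [hset, ← gaussianReal_Iio_eq_integral]
    -- A bound of at least 1 is trivial for a difference of probabilities; otherwise δ is half the
    -- bound and satisfies δ ≤ 1/2.
    rcases le_total 1 (berryBound n (q / n)) with h1 | h1
    · refine le_trans ?_ h1
      rw [abs_le]
      constructor <;> linarith [measureReal_nonneg (μ := P.map Y) (s := {x | (x - c) / √v < r}),
        measureReal_le_one (μ := P.map Y) (s := {x | (x - c) / √v < r}),
        measureReal_nonneg (μ := gaussianReal 0 1) (s := Iio r),
        measureReal_le_one (μ := gaussianReal 0 1) (s := Iio r)]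
    · have hB : 0 < berryBound n (q / n) := by
        have : 0 < 1 - (q : ℝ) / n := by linarith
        rw [berryBound]
        positivity
      have := abs_measureReal_standardized_sub_gaussian_le hv0
        (cubic_coeff_div_sqrt_pow_le hq hqn hv) (by linarith) (by linarith) hf
        (fun s t hst => by rw [hYlaw]; exact norm_charFun_log_sphereVolume_le hpn hst) r
      linarith
  · intro φ hφ hle
    exact berryBound_le hq hqn hφ.2 hle
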